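/- Let $s=(s_1,\dots,s_N)$ range over the configurations of $N$ discrete degrees of freedom, $s_i$ having $d_i$ values. A tensor network state is given by a finite graph whose nodes $v$ carry complex tensors $T_v$ and whose edges $e$ (bonds, of dimension $\chi_e$) are contracted indices, each physical index $s_i$ being attached to one tensor; its amplitudes are $\Psi(s)=\sum_{\beta}\prod_v T_v(\beta|_v,s|_v)$, the sum running over all values $\beta$ of the bond indices. A contraction scheme is a nested sequence of pairwise contractions that uses every tensor exactly once. Its run-time $k$ is the number of elementary steps for one configuration: the number of entries of $T_v$ for each tensor (fixing its physical indices to their values), plus, for each pairwise contraction of two (possibly already contracted) tensors, the product of the dimensions of all the bonds that are legs of at least one of the two. The network has (at most) $b\ge 1$ bits of precision if the real and imaginary parts of all tensor entries and of all amplitudes $\Psi(s)$ are zero or of absolute value between $2^{-b}$ and $2^{b}$ (as all signed fixed-point numbers $\pm n/2^p$ with integers $0\le n<2^b$, $0\le p\le b$ are). A neural network is here a finite directed acyclic graph whose inputs are the indicators $\mathbb 1[s_i=a]$, whose every other node has the value $v(s)=\sigma\big(b_v+\sum_{(u,v)\in E}W_{u,v}\,u(s)\big)$ with real $b_v, W_{u,v}$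 and $\sigma(x)=\ln(e^x+1)$ (softplus), and whose two outputs $g_1,g_2$ are distinct nodes without outgoing edges, at which $\sigma$ may be replaced by the identity. There is a universal constant $C>0$ such that the following holds for all $N$ and $d_1,\dots,d_N$. For every tensor network with $b\ge1$ bits of precision whose amplitudes all satisfy $\operatorname{Re}\Psi(s)\neq0$ and $\operatorname{Im}\Psi(s)\ne0$, every contraction scheme of it, of run-time $k$, and every $0<\epsilon<1$, there is a neural network with $$\big|g_1(s)+i\,g_2(s)-\log\Psi(s)\big|<\epsilon\quad\text{for all } s$$ (principal branch of the logarithm) and with at most $$C\left(k+\ln^2\!\left(\frac{kb}{\epsilon}\right)+\ln\!\left(\frac1\epsilon\right)\sqrt{\frac1\epsilon}\right)$$ edges. -/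

import Mathlib

open scoped BigOperators

/-! ### Tensor networks -/

/-- A tensor network for a system of `N` discrete degrees of freedom, the `i`-th one with `d i`
values. It is a finite undirected (multi)graph: its nodes `Fin nodes` carry tensors and its edges
`Fin bonds` are the contracted indices; the physical index `i` is attached to the tensor `site i`.
The tensor at `v` has one leg for each bond that meets `v` and one for each physical index attached
to `v`. (A bond with equal ends stands for a partial trace of one tensor, for which only the entries
with equal values of the two legs are needed.) -/
structure TensorNetwork (N : ℕ) (d : Fin N → ℕ) where
  nodes : ℕ
  bonds : ℕ
  bondDim : Fin bonds → ℕ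
  ends : Fin bonds → Sym2 (Fin nodes)
  site : Fin N → Fin nodes
  entry : (v : Fin nodes) → ((e : {e // v ∈ ends e}) → Fin (bondDim e)) →
    ((i : {i // site i = v}) → Fin (d i)) → ℂ

/-- The amplitude `Ψ(s)`: the sum, over all values of the contracted indices, of the product of all
the tensors. -/
def TensorNetwork.amplitude {N : ℕ} {d : Fin N → ℕ} (T : TensorNetwork N d)
    (s : (i : Fin N) → Fin (d i)) : ℂ :=
  ∑ β : ((e : Fin T.bonds) → Fin (T.bondDim e)),
    ∏ v : Fin T.nodes, T.entry v (fun e => β e) (fun i => s i)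

/-- The number of entries of the tensor at `v`. -/
def TensorNetwork.tensorSize {N : ℕ} {d : Fin N → ℕ} (T : TensorNetwork N d)
    (v : Fin T.nodes) : ℕ :=
  (∏ e : {e // v ∈ T.ends e}, T.bondDim e) * ∏ i : {i // T.site i = v}, d i

/-- The bonds that join the set `S` of tensors to its complement, which are the legs of the tensor
obtained by contracting the tensors of `S` with each other. -/
def TensorNetwork.openBonds {N : ℕ} {d : Fin N → ℕ} (T : TensorNetwork N d)
    (S : Finset (Fin T.nodes)) : Finset (Fin T.bonds) :=
  Finset.univ.filter fun e => (∃ v ∈ S, v ∈ T.ends e) ∧ ∃ v ∉ S, v ∈ T.ends e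

/-! ### Contraction schemes and their run-time -/

/-- A nested sequence of pairwise contractions of tensors. -/
inductive ContractionTree (n : ℕ) where
  | tensor (v : Fin n) : ContractionTree n
  | contract (l r : ContractionTree n) : ContractionTree n

/-- The tensors that are contracted, with repetitions. -/
def ContractionTree.leaves {n : ℕ} : ContractionTree n → List (Fin n)
  | .tensor v => [v]
  | .contract l r => l.leaves ++ r.leaves

/-- The number of steps, for one configuration `s`, of a nested sequence of pairwise contractions.
Fixing the physical indices of a tensor to their values takes one step for each of its entries.
Contracting two tensors takes one scalar multiplication (and at most one addition) for each joint
value of all of their legs, those which they share being summed over. -/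
def TensorNetwork.cost {N : ℕ} {d : Fin N → ℕ} (T : TensorNetwork N d) :
    ContractionTree T.nodes → ℕ
  | .tensor v => T.tensorSize v
  | .contract l r => T.cost l + T.cost r +
      ∏ e ∈ T.openBonds l.leaves.toFinset ∪ T.openBonds r.leaves.toFinset, T.bondDim e

/-- A contraction scheme: pairwise contractions in which every tensor is used exactly once. -/
structure ContractionScheme {N : ℕ} {d : Fin N → ℕ} (T : TensorNetwork N d) where
  tree : ContractionTree T.nodes
  each_once : ∀ v, tree.leaves.count v = 1

/-- The run-time of a contraction scheme. -/
def ContractionScheme.runTime {N : ℕ} {d : Fin N → ℕ} {T : TensorNetwork N d}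
    (S : ContractionScheme T) : ℕ :=
  T.cost S.tree

/-! ### Bits of precision -/

/-- A real number that neither overflows nor underflows in fixed-point arithmetic with `b` bits
before and `b` bits after the binary point. Every fixed-point number `± n / 2 ^ p` with
`n < 2 ^ b` and `p ≤ b` is of this kind. -/
def InBitRange (b : ℕ) (x : ℝ) : Prop :=
  x = 0 ∨ (((2 : ℝ) ^ b)⁻¹ ≤ |x| ∧ |x| ≤ (2 : ℝ) ^ b)

/-- The parameters (tensor entries) and the computed amplitudes need at most `b` bits. -/
def TensorNetwork.HasPrecision {N : ℕ} {d : Fin N → ℕ} (T : TensorNetwork N d) (b : ℕ) : Prop :=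
  (∀ v β σ, InBitRange b (T.entry v β σ).re ∧ InBitRange b (T.entry v β σ).im) ∧
    ∀ s, InBitRange b (T.amplitude s).re ∧ InBitRange b (T.amplitude s).im

/-! ### Neural networks -/

/-- The softplus activation function. -/
noncomputable def softplus (x : ℝ) : ℝ := Real.log (Real.exp x + 1)

/-- A feed-forward softplus network with inputs indexed by `ι` and two outputs: a finite directed
acyclic graph, whose neurons `Fin size` are listed in a topological order. The two outputs are
distinct roots (neurons without outgoing edges), and only they may use the identity as activation
function. -/
structure NeuralNetwork (ι : Type) where
  size : ℕ
  edges : Finset ((ι ⊕ Fin size) × Fin size)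
  acyclic : ∀ u v : Fin size, (Sum.inr u, v) ∈ edges → u < v
  weight : ι ⊕ Fin size → Fin size → ℝ
  bias : Fin size → ℝ
  root : Fin 2 → Fin size
  root_injective : Function.Injective root
  root_isRoot : ∀ j v, (Sum.inr (root j), v) ∉ edges
  linear : Finset (Fin size)
  linear_subset : ∀ v ∈ linear, ∃ j, v = root j

open Classical in
/-- The value of the neuron `v` on the input `x`: the activation function applied to the bias plus
the weighted sum of the values at the sources of the edges into `v`. -/
noncomputable def NeuralNetwork.value {ι : Type} [Fintype ι] (net : NeuralNetwork ι) (x : ι → ℝ)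
    (v : Fin net.size) : ℝ :=
  (if v ∈ net.linear then id else softplus)
    (net.bias v +
      ((∑ u : ι, if (Sum.inl u, v) ∈ net.edges then net.weight (Sum.inl u) v * x u else 0) +
        ∑ u : Fin v.val, if (Sum.inr (u.castLE v.isLt.le), v) ∈ net.edges then
          net.weight (Sum.inr (u.castLE v.isLt.le)) v * net.value x (u.castLE v.isLt.le) else 0))
termination_by v.val
decreasing_by exact u.isLt

/-- The two outputs of the network, as one complex number `g₁ + i g₂`. -/
noncomputable def NeuralNetwork.output {ι : Type} [Fintype ι] (net : NeuralNetwork ι)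
    (x : ι → ℝ) : ℂ :=
  (net.value x (net.root 0) : ℂ) + Complex.I * (net.value x (net.root 1) : ℂ)

/-- The inputs that encode a configuration `s`: the indicators of `s i = a`. -/
def indicatorInput {N : ℕ} {d : Fin N → ℕ} (s : (i : Fin N) → Fin (d i)) :
    (Σ i : Fin N, Fin (d i)) → ℝ :=
  fun p => if s p.1 = p.2 then 1 else 0

/-! There are only finitely many configurations and the weights may be arbitrarily large or small,
so a few softplus neurons imitate, to any accuracy and at no further cost in edges, every activation
function that is a locally uniform limit of combinations of three softplus functions. Three kinds of
limits suffice: the identity (odd part of softplus), the square (softplus probed near 0) and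
combinations of three ReLUs (softplus seen from afar). It is enough to construct a circuit of such
limit gates; `Builds.simulate` shows that replacing each gate by three neurons, each reading three
neurons per source, multiplies the edge count by at most 9.

Squares give products by polarization, and ReLUs give exact step functions and indicators on a
finite set. The contraction scheme is then executed literally:
`TensorNetwork.reach_contraction_singleton` looks up each tensor,
`TensorNetwork.reach_contraction_union` performs each pairwise contraction, and the total is linear
in the run-time `k`.

The logarithm is found by bisection (`Reach.bisect`). For both `log |Ψ|²` and the argument, a pair
of functions of the unknown is available on which translations of the unknown act linearly: `(1, exp
u - 1)` and `(r cos u, r sin u)`. Hence comparing the unknown with a threshold only needs the sign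
of a linear combination, and each binary digit costs 23 edges. About `log₂ (b / ε)` digits are
enough, and a linear expression in `ln (b / ε)` is bounded by a constant plus its square. The last
term of the asserted bound only has to be nonnegative. -/

/-- `Builds 𝒜 P n Q`: starting from the functions in `P`, a network with `n` edges and activation
functions in `𝒜` computes the functions in `Q`. -/
inductive Builds {X : Type} (𝒜 : Set (ℝ → ℝ)) (P : Set (X → ℝ)) : ℕ → Set (X → ℝ) → Prop
  | init : Builds 𝒜 P 0 P
  | gate {n : ℕ} {Q : Set (X → ℝ)} (h : Builds 𝒜 P n Q) {φ : ℝ → ℝ} (hφ : φ ∈ 𝒜)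
      (S : Finset (X → ℝ)) (hS : ↑S ⊆ Q) (w : (X → ℝ) → ℝ) (c : ℝ) :
      Builds 𝒜 P (n + S.card) (insert (fun s => φ (c + ∑ u ∈ S, w u * u s)) Q)

/-- The continuous functions that are locally uniform limits of affine combinations of three
softplus neurons of one variable. -/
def softplusLimits : Set (ℝ → ℝ) :=
  {φ | Continuous φ ∧ ∀ R δ : ℝ, 0 < δ → ∃ (c : ℝ) (a w e : Fin 3 → ℝ), ∀ x : ℝ, |x| ≤ R →
    |φ x - (c + ∑ i, a i * softplus (w i * x + e i))| ≤ δ}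

/-- Edges are counted by distinct source functions, whereas sums are written over families with
possible repetitions; the coefficients of equal functions are added up. -/
theorem exists_finset_sum {X J : Type} [Fintype J] (u : J → X → ℝ) (a : J → ℝ) :
    ∃ (S : Finset (X → ℝ)) (w : (X → ℝ) → ℝ), (↑S ⊆ Set.range u) ∧ S.card ≤ Fintype.card J ∧
      ∀ s, ∑ f ∈ S, w f * f s = ∑ j, a j * u j s := by
  classical
  refine ⟨Finset.univ.image u, fun f => ∑ j with u j = f, a j, by simp,
    Finset.card_image_le.trans (by simp), fun s => ?_⟩
  rw [← Finset.sum_fiberwise_of_maps_to (s := Finset.univ) (t := Finset.univ.image u) (g := u)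
    (fun j _ => Finset.mem_image_of_mem _ (Finset.mem_univ j))]
  refine Finset.sum_congr rfl fun f _ => ?_
  rw [Finset.sum_mul]
  refine Finset.sum_congr rfl fun j hj => ?_
  rw [(Finset.mem_filter.1 hj).2]

theorem Builds.subset {X : Type} {𝒜 : Set (ℝ → ℝ)} {P Q : Set (X → ℝ)} {n : ℕ}
    (h : Builds 𝒜 P n Q) : P ⊆ Q := by
  induction h with
  | init => exact subset_rfl
  | gate _ _ S hS w c ih => exact ih.trans (Set.subset_insert _ _)

/-- Induction on the circuit: a gate is never computed itself, but represented by an affine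
combination of three softplus neurons, which is absorbed into the weights and biases of whatever
reads it. A gate with `r` sources thus becomes three neurons with at most `3 r` sources each. The
accuracy is quantified inside the induction because each gate dictates how well its sources must be
approximated. -/
theorem Builds.simulate {X : Type} [Finite X] {P Q : Set (X → ℝ)} {n : ℕ}
    (h : Builds softplusLimits P n Q) : ∀ δ : ℝ, 0 < δ → ∃ (m : ℕ) (Q' : Set (X → ℝ)),
      m ≤ 9 * n ∧ Builds {softplus} P m Q' ∧ ∀ q ∈ Q, ∃ (c : ℝ) (a : Fin 3 → ℝ)
        (u : Fin 3 → X → ℝ), (∀ i, u i ∈ Q') ∧ ∀ s, |q s - (c + ∑ i, a i * u i s)| ≤ δ := by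
  induction h with
  | init =>
    intro δ hδ
    refine ⟨0, P, by simp, Builds.init, fun q hq => ⟨0, ![1, 0, 0], fun _ => q, fun _ => hq, ?_⟩⟩
    intro s
    simp [Fin.sum_univ_three, hδ.le]
  | @gate n Q _ φ hφ S hS w c ih =>
    intro δ hδ
    obtain ⟨hcont, happ⟩ := hφ
    set arg : X → ℝ := fun s => c + ∑ u ∈ S, w u * u s with harg
    obtain ⟨R, hR⟩ : ∃ R : ℝ, ∀ s, |arg s| ≤ R := by
      obtain ⟨R, hR⟩ := (Set.finite_range fun s => |arg s|).bddAbove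
      exact ⟨R, fun s => hR ⟨s, rfl⟩⟩
    -- Half of `δ` pays for replacing `φ` by softplus functions, half for the perturbed argument;
    -- the radius `R + 1` leaves room for a perturbation of at most 1.
    obtain ⟨c₁, a₁, w₁, e₁, h₁⟩ := happ (R + 1) (δ / 2) (by linarith)
    obtain ⟨η, hη, hη'⟩ : ∃ η : ℝ, 0 < η ∧ ∀ s x, |x - arg s| < η → |φ x - φ (arg s)| < δ / 2 := by
      have : ∀ s, ∀ᶠ η in nhdsWithin (0 : ℝ) (Set.Ioi 0),
          ∀ x, |x - arg s| < η → |φ x - φ (arg s)| < δ / 2 := by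
        intro s
        obtain ⟨η, hη, h⟩ := Metric.continuous_iff.1 hcont (arg s) (δ / 2) (by linarith)
        filter_upwards [Ioo_mem_nhdsGT hη] with η' hη' x hx
        exact h x (lt_trans hx hη'.2)
      obtain ⟨η, h1, h2⟩ := ((Filter.eventually_all.2 this).and self_mem_nhdsWithin).exists
      exact ⟨η, h2, h1⟩
    set W : ℝ := ∑ u ∈ S, |w u| with hW
    have hW0 : 0 ≤ W := Finset.sum_nonneg fun _ _ => abs_nonneg _
    set ρ : ℝ := min (η / 2) 1 with hρ
    have hρ0 : 0 < ρ := lt_min (by linarith) one_pos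
    -- The second bound keeps the error of the weighted sum below `ρ`; the bound `δ` serves the
    -- functions already computed.
    obtain ⟨m, Q', hm, hB, hQ'⟩ := ih (min δ (ρ / (W + 1)))
      (lt_min hδ (div_pos hρ0 (by linarith)))
    choose! c₂ a₂ u₂ hu₂ h₂ using hQ'
    obtain ⟨S', w', hS', hcard, hsum⟩ := exists_finset_sum
      (fun p : S × Fin 3 => u₂ p.1 p.2) (fun p => w p.1 * a₂ p.1 p.2)
    have hS'Q : (↑S' : Set (X → ℝ)) ⊆ Q' := by
      refine hS'.trans ?_
      rintro _ ⟨p, rfl⟩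
      exact hu₂ _ (hS p.1.2) _
    set c' : ℝ := c + ∑ u ∈ S, w u * c₂ u with hc'
    set arg' : X → ℝ := fun s => c' + ∑ u ∈ S', w' u * u s with harg'
    have hclose : ∀ s, |arg' s - arg s| ≤ ρ := by
      intro s
      have : arg' s - arg s =
          ∑ u ∈ S, w u * ((c₂ u + ∑ i, a₂ u i * u₂ u i s) - u s) := by
        simp only [harg', harg, hc', hsum, Fintype.sum_prod_type]
        rw [Finset.sum_coe_sort S (fun u => ∑ i, w u * a₂ u i * u₂ u i s)]
        simp only [mul_sub, mul_add, Finset.sum_sub_distrib, Finset.sum_add_distrib,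
          Finset.mul_sum, mul_assoc]
        ring
      rw [this]
      calc _ ≤ ∑ u ∈ S, |w u * ((c₂ u + ∑ i, a₂ u i * u₂ u i s) - u s)| :=
            Finset.abs_sum_le_sum_abs _ _
        _ ≤ ∑ u ∈ S, |w u| * (ρ / (W + 1)) := by
            refine Finset.sum_le_sum fun u hu => ?_
            rw [abs_mul, abs_sub_comm]
            exact mul_le_mul_of_nonneg_left ((h₂ u (hS hu) s).trans (min_le_right _ _))
              (abs_nonneg _)
        _ = W * (ρ / (W + 1)) := by rw [← Finset.sum_mul]
        _ ≤ ρ := by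
            rw [mul_div_assoc', div_le_iff₀ (by linarith)]
            nlinarith
    set g : Fin 3 → X → ℝ := fun i s =>
      softplus ((w₁ i * c' + e₁ i) + ∑ u ∈ S', (w₁ i * w' u) * u s) with hg
    have hg' : ∀ i s, g i s = softplus (w₁ i * arg' s + e₁ i) := by
      intro i s
      simp only [hg, harg', mul_add, Finset.mul_sum, mul_assoc]
      congr 1
      ring
    have hB₃ := ((hB.gate (Set.mem_singleton _) S' hS'Q (fun u => w₁ 0 * w' u)
      (w₁ 0 * c' + e₁ 0)).gate (Set.mem_singleton _) S' (hS'Q.trans (Set.subset_insert _ _))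
      (fun u => w₁ 1 * w' u) (w₁ 1 * c' + e₁ 1)).gate (Set.mem_singleton _) S'
      (hS'Q.trans ((Set.subset_insert _ _).trans (Set.subset_insert _ _)))
      (fun u => w₁ 2 * w' u) (w₁ 2 * c' + e₁ 2)
    refine ⟨_, _, ?_, hB₃, ?_⟩
    · have : Fintype.card (S × Fin 3) = S.card * 3 := by simp
      omega
    · intro q hq
      rcases hq with rfl | hq
      · refine ⟨c₁, a₁, g, ?_, fun s => ?_⟩
        · intro i
          fin_cases i
          · exact Or.inr (Or.inr (Or.inl rfl))
          · exact Or.inr (Or.inl rfl)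
          · exact Or.inl rfl
        · have hx : |arg' s| ≤ R + 1 := by
            have := hclose s
            have h3 := hR s
            have h4 : ρ ≤ 1 := min_le_right _ _
            rw [abs_le] at *
            constructor <;> linarith
          have k1 := h₁ _ hx
          have k2 := hη' s (arg' s) (by
            have h4 : ρ ≤ η / 2 := min_le_left _ _
            have := hclose s
            linarith)
          simp only [hg']
          have k3 : φ (arg s) - (c₁ + ∑ i, a₁ i * softplus (w₁ i * arg' s + e₁ i)) =
            (φ (arg' s) - (c₁ + ∑ i, a₁ i * softplus (w₁ i * arg' s + e₁ i))) -
              (φ (arg' s) - φ (arg s)) := by ring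
          show |φ (arg s) - _| ≤ δ
          rw [k3]
          refine (abs_sub _ _).trans ?_
          linarith
      · refine ⟨c₂ q, a₂ q, u₂ q, fun i => Or.inr (Or.inr (Or.inr (hu₂ q hq i))), fun s =>
          (h₂ q hq s).trans (min_le_left _ _)⟩

/-! ### From circuits to neural networks as graphs -/

/-- The network with `m` softplus neurons and two linear outputs, the neuron `k` having the sources
`src k`. -/
noncomputable def layeredNetwork {ι : Type} [Fintype ι] (m : ℕ) (src : ℕ → Finset (ι ⊕ ℕ))
    (w : ℕ → ι ⊕ ℕ → ℝ) (bias : ℕ → ℝ) (h : ∀ k j, Sum.inr j ∈ src k → j < k ∧ j < m) :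
    NeuralNetwork ι where
  size := m + 2
  edges := by
    classical
    exact Finset.univ.filter fun p => Sum.map id Fin.val p.1 ∈ src p.2.val
  acyclic := by
    intro u v huv
    exact (h _ _ (by simpa using huv)).1
  weight := fun p v => w v (Sum.map id Fin.val p)
  bias := fun v => bias v
  root := fun j => ⟨m + j, by omega⟩
  root_injective := by
    intro i j hij
    simpa [Fin.ext_iff] using hij
  root_isRoot := by
    intro j v hv
    have := (h v (m + j) (by simpa using hv)).2
    omega
  linear := Finset.univ.filter fun v => m ≤ v.val
  linear_subset := by
    intro v hv
    have hv : m ≤ v.val := by simpa using hv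
    refine ⟨⟨v.val - m, by omega⟩, Fin.ext ?_⟩
    simp; omega

theorem mem_layeredNetwork_edges {ι : Type} [Fintype ι] {m : ℕ} {src : ℕ → Finset (ι ⊕ ℕ)}
    {w : ℕ → ι ⊕ ℕ → ℝ} {bias : ℕ → ℝ} {h : ∀ k j, Sum.inr j ∈ src k → j < k ∧ j < m}
    {p : ι ⊕ Fin (m + 2)} {v : Fin (m + 2)} :
    (p, v) ∈ (layeredNetwork m src w bias h).edges ↔ Sum.map id Fin.val p ∈ src v := by
  classical
  exact Finset.mem_filter.trans ⟨fun h => h.2, fun h => ⟨Finset.mem_univ _, h⟩⟩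

theorem mem_layeredNetwork_linear {ι : Type} [Fintype ι] {m : ℕ} {src : ℕ → Finset (ι ⊕ ℕ)}
    {w : ℕ → ι ⊕ ℕ → ℝ} {bias : ℕ → ℝ} {h : ∀ k j, Sum.inr j ∈ src k → j < k ∧ j < m}
    {v : Fin (m + 2)} :
    v ∈ (layeredNetwork m src w bias h).linear ↔ m ≤ v.val :=
  Finset.mem_filter.trans ⟨fun h => h.2, fun h => ⟨Finset.mem_univ _, h⟩⟩

theorem layeredNetwork_card_edges {ι : Type} [Fintype ι] (m : ℕ) (src : ℕ → Finset (ι ⊕ ℕ))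
    (w : ℕ → ι ⊕ ℕ → ℝ) (bias : ℕ → ℝ) (h : ∀ k j, Sum.inr j ∈ src k → j < k ∧ j < m) :
    (layeredNetwork m src w bias h).edges.card ≤ ∑ k ∈ Finset.range (m + 2), (src k).card := by
  classical
  rw [← Finset.card_sigma]
  refine Finset.card_le_card_of_injOn (fun p => ⟨p.2.val, Sum.map id Fin.val p.1⟩) ?_ ?_
  · intro p hp
    have hp : Sum.map id Fin.val p.1 ∈ src p.2.val :=
      mem_layeredNetwork_edges.1 hp
    simp only [Finset.coe_sigma, Set.mem_sigma_iff, Finset.mem_coe, Finset.mem_range]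
    exact ⟨p.2.isLt, hp⟩
  · rintro ⟨p, v⟩ _ ⟨p', v'⟩ _ hpp
    simp only [Sigma.mk.injEq, heq_eq_eq] at hpp
    obtain ⟨h1, h2⟩ := hpp
    have h3 : Function.Injective (Sum.map (id : ι → ι) (Fin.val : Fin (m + 2) → ℕ)) :=
      Function.injective_id.sumMap Fin.val_injective
    exact Prod.ext (h3 h2) (Fin.ext h1)

theorem layeredNetwork_value {ι : Type} [Fintype ι] (m : ℕ) (src : ℕ → Finset (ι ⊕ ℕ))
    (w : ℕ → ι ⊕ ℕ → ℝ) (bias : ℕ → ℝ) (h : ∀ k j, Sum.inr j ∈ src k → j < k ∧ j < m)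
    (x : ι → ℝ) (val : ℕ → ℝ)
    (hval : ∀ k < m + 2, val k = (if m ≤ k then id else softplus)
      (bias k + ∑ p ∈ src k, w k p * Sum.elim x val p)) (k : ℕ) (hk : k < m + 2) :
    (layeredNetwork m src w bias h).value x ⟨k, hk⟩ = val k := by
  classical
  induction k using Nat.strong_induction_on with
  | _ k ih =>
    rw [NeuralNetwork.value, hval k hk]
    refine congr ?_ ?_
    · exact if_congr mem_layeredNetwork_linear rfl rfl
    · refine congrArg₂ (· + ·) rfl ?_
      have hsrc : src k = (Finset.univ.filter fun p : ι ⊕ Fin k =>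
          Sum.map id Fin.val p ∈ src k).map
            ⟨Sum.map id Fin.val, Function.injective_id.sumMap Fin.val_injective⟩ := by
        ext p
        simp only [Finset.mem_map, Finset.mem_filter, Finset.mem_univ, true_and,
          Function.Embedding.coeFn_mk]
        constructor
        · intro hp
          rcases p with i | j
          · exact ⟨Sum.inl i, hp, rfl⟩
          · exact ⟨Sum.inr ⟨j, (h k j hp).1⟩, hp, rfl⟩
        · rintro ⟨q, hq, rfl⟩
          exact hq
      conv_rhs => rw [hsrc]
      rw [Finset.sum_map, Finset.sum_filter, Fintype.sum_sum_type]
      congr 1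
      · exact Finset.sum_congr rfl fun i _ => if_congr mem_layeredNetwork_edges rfl rfl
      · refine Finset.sum_congr rfl fun j _ => if_congr mem_layeredNetwork_edges ?_ rfl
        exact congrArg (_ * ·) (ih j.val j.isLt (j.isLt.trans hk))

/-- Numbering the gates in order of construction turns the sets of functions into a graph: each
function of `Q` is assigned an input or an earlier neuron. The assignment is injective on `Q`
because taking values inverts it, so no edge count changes. -/
theorem Builds.exists_sources {X ι : Type} (inp : ι → X → ℝ) {n : ℕ}
    {Q : Set (X → ℝ)} (hB : Builds {softplus} (Set.range inp) n Q) :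
    ∃ (m : ℕ) (src : ℕ → Finset (ι ⊕ ℕ)) (w : ℕ → ι ⊕ ℕ → ℝ) (bias : ℕ → ℝ) (val : ℕ → X → ℝ),
      (∀ k j, Sum.inr j ∈ src k → j < k ∧ j < m) ∧
      (∀ k < m, ∀ s, val k s = softplus (bias k + ∑ p ∈ src k, w k p * Sum.elim inp val p s)) ∧
      ∑ k ∈ Finset.range m, (src k).card = n ∧
      ∀ q ∈ Q, ∃ p : ι ⊕ ℕ, (∀ j, p = Sum.inr j → j < m) ∧ Sum.elim inp val p = q := by
  classical
  induction hB with
  | init =>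
    refine ⟨0, fun _ => ∅, fun _ _ => 0, fun _ => 0, fun _ _ => 0, by simp, by simp, by simp, ?_⟩
    rintro _ ⟨i, rfl⟩
    exact ⟨Sum.inl i, by simp, rfl⟩
  | @gate n Q _ φ hφ S hS w' c ih =>
    obtain rfl : φ = softplus := hφ
    obtain ⟨m, src, w, bias, val, h1, h2, h3, h4⟩ := ih
    choose! p hp1 hp2 using h4
    set val' : ℕ → X → ℝ :=
      Function.update val m (fun s => softplus (c + ∑ u ∈ S, w' u * u s)) with hval'
    have hpv : ∀ q : ι ⊕ ℕ, (∀ j, q = Sum.inr j → j < m) →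
        Sum.elim inp val' q = Sum.elim inp val q := by
      intro q hq
      rcases q with i | j
      · rfl
      · have := hq j rfl
        simp [hval', Function.update_of_ne this.ne]
    refine ⟨m + 1, Function.update src m (S.image p),
      Function.update w m (fun q => w' (Sum.elim inp val q)), Function.update bias m c, val',
      ?_, ?_, ?_, ?_⟩
    · intro k j hj
      rcases eq_or_ne k m with rfl | hk
      · rw [Function.update_self, Finset.mem_image] at hj
        obtain ⟨u, hu, hu'⟩ := hj
        have := hp1 u (hS hu) j hu'
        omega
      · rw [Function.update_of_ne hk] at hj
        have := h1 k j hj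
        omega
    · intro k hk s
      rcases eq_or_ne k m with rfl | hk'
      · simp only [Function.update_self]
        rw [Finset.sum_image]
        · rw [hval', Function.update_self, ← hval']
          congr 2
          refine Finset.sum_congr rfl fun u hu => ?_
          rw [hpv _ (hp1 u (hS hu)), hp2 u (hS hu)]
        · intro u hu v hv huv
          rw [← hp2 u (hS hu), ← hp2 v (hS hv), huv]
      · simp only [Function.update_of_ne hk', hval']
        rw [h2 k (by omega), ← hval']
        congr 2
        refine Finset.sum_congr rfl fun q hq => ?_
        rw [hpv q]
        rintro j rfl
        exact (h1 k j hq).2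
    · rw [Finset.sum_range_succ, Function.update_self, Finset.card_image_of_injOn, ← h3]
      · congr 1
        refine Finset.sum_congr rfl fun k hk => ?_
        rw [Function.update_of_ne (Finset.mem_range.1 hk).ne]
      · intro u hu v hv huv
        rw [← hp2 u (hS hu), ← hp2 v (hS hv), huv]
    · intro q hq
      rcases hq with rfl | hq
      · refine ⟨Sum.inr m, by simp, ?_⟩
        simp [hval']
      · refine ⟨p q, fun j hj => (hp1 q hq j hj).trans (by omega), ?_⟩
        rw [hpv _ (hp1 q hq), hp2 q hq]

/-- Two affine combinations of the functions computed by a softplus network are the outputs of a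
neural network. -/
theorem Builds.exists_neuralNetwork {X ι : Type} [Fintype ι] (inp : ι → X → ℝ) {n : ℕ}
    {Q : Set (X → ℝ)} (hB : Builds {softplus} (Set.range inp) n Q)
    (S : Fin 2 → Finset (X → ℝ)) (hS : ∀ j, ↑(S j) ⊆ Q) (w : Fin 2 → (X → ℝ) → ℝ)
    (c : Fin 2 → ℝ) :
    ∃ net : NeuralNetwork ι, net.edges.card ≤ n + (S 0).card + (S 1).card ∧
      ∀ s j, net.value (fun i => inp i s) (net.root j) = c j + ∑ u ∈ S j, w j u * u s := by
  classical
  obtain ⟨m, src, w', bias, val, h1, h2, h3, h4⟩ := hB.exists_sources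
  choose! p hp1 hp2 using h4
  -- The neurons `m` and `m + 1` are the outputs; all others keep their numbers below `m`.
  set o : ℕ → Fin 2 := fun k => if k = m then 0 else 1 with ho
  have hom : o m = 0 := by simp [ho]
  have hom' : o (m + 1) = 1 := by simp [ho]
  set src' : ℕ → Finset (ι ⊕ ℕ) := fun k => if k < m then src k else (S (o k)).image p with hsrc'
  set W : ℕ → ι ⊕ ℕ → ℝ := fun k q => if k < m then w' k q else w (o k) (Sum.elim inp val q)
    with hW
  set B : ℕ → ℝ := fun k => if k < m then bias k else c (o k) with hBdef
  set V : ℕ → X → ℝ := fun k s => if k < m then val k s else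
    c (o k) + ∑ u ∈ S (o k), w (o k) u * u s with hV
  have hsrc : ∀ k j, Sum.inr j ∈ src' k → j < k ∧ j < m := by
    intro k j hj
    by_cases hk : k < m
    · exact h1 k j (by simpa [hsrc', hk] using hj)
    · simp only [hsrc', hk, if_false, Finset.mem_image] at hj
      obtain ⟨u, hu, hu'⟩ := hj
      have := hp1 u (hS _ hu) j hu'
      omega
  have hpV : ∀ s, ∀ q : ι ⊕ ℕ, (∀ j, q = Sum.inr j → j < m) →
      Sum.elim (fun i => inp i s) (fun k => V k s) q = Sum.elim inp val q s := by
    intro s q hq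
    rcases q with i | j
    · rfl
    · simp [hV, hq j rfl]
  have hinj : ∀ j, Set.InjOn p (S j) := by
    intro j u hu v hv huv
    rw [← hp2 u (hS j hu), ← hp2 v (hS j hv), huv]
  refine ⟨layeredNetwork m src' W B hsrc, ?_, ?_⟩
  · refine (layeredNetwork_card_edges _ _ _ _ _).trans ?_
    rw [Finset.sum_range_succ, Finset.sum_range_succ]
    have e1 : ∑ k ∈ Finset.range m, (src' k).card = n := by
      rw [← h3]
      refine Finset.sum_congr rfl fun k hk => ?_
      simp [hsrc', Finset.mem_range.1 hk]
    have e2 : (src' m).card ≤ (S 0).card := by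
      simp only [hsrc', lt_irrefl, if_false, hom]
      exact Finset.card_image_le
    have e3 : (src' (m + 1)).card ≤ (S 1).card := by
      simp only [hsrc', hom', show ¬ (m + 1 < m) by omega, if_false]
      exact Finset.card_image_le
    omega
  · intro s j
    have key := layeredNetwork_value m src' W B hsrc (fun i => inp i s) (fun k => V k s) (by
      intro k hk
      by_cases hkm : k < m
      · simp only [hV, hkm, if_true, not_le.2 hkm, if_false, hsrc', hBdef, hW]
        rw [h2 k hkm]
        congr 2
        refine Finset.sum_congr rfl fun q hq => ?_
        rw [← hpV s q]
        rintro j rfl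
        exact (h1 k j hq).2
      · simp only [hV, hkm, if_false, not_lt.1 hkm, if_true, hsrc', hBdef, hW, id]
        congr 1
        rw [Finset.sum_image (hinj _)]
        refine Finset.sum_congr rfl fun u hu => ?_
        have e := hpV s (p u) (hp1 u (hS _ hu))
        rw [hp2 u (hS _ hu)] at e
        simp only [hV] at e
        rw [hp2 u (hS _ hu), e]) (m + j) (by omega)
    have hr : (layeredNetwork m src' W B hsrc).root j =
        ⟨m + j, Nat.add_lt_add_left j.isLt m⟩ := rfl
    rw [hr]
    refine key.trans ?_
    have : ¬ (m + (j : ℕ) < m) := by omega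
    have hoj : o (m + j) = j := by
      fin_cases j
      · exact hom
      · exact hom'
    simp only [hV, this, if_false, hoj]

/-! ### Activation functions obtained as limits of softplus -/

theorem softplus_sub_softplus_neg (x : ℝ) : softplus x - softplus (-x) = x := by
  unfold softplus
  rw [← Real.log_div (by positivity) (by positivity)]
  have : (Real.exp x + 1) / (Real.exp (-x) + 1) = Real.exp x := by
    rw [div_eq_iff (by positivity), mul_add, ← Real.exp_add]
    simp [add_comm]
  rw [this, Real.log_exp]

theorem abs_softplus_sub_max (x : ℝ) : |softplus x - max 0 x| ≤ Real.log 2 := by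
  have key : ∀ y : ℝ, y ≤ 0 → 0 ≤ softplus y ∧ softplus y ≤ Real.log 2 := by
    intro y hy
    have h1 : Real.exp y ≤ 1 := Real.exp_le_one_iff.2 hy
    have h0 := Real.exp_pos y
    exact ⟨Real.log_nonneg (by linarith), Real.log_le_log (by positivity) (by linarith)⟩
  rcases le_total x 0 with hx | hx
  · rw [max_eq_left hx, sub_zero, abs_of_nonneg (key x hx).1]
    exact (key x hx).2
  · have h := softplus_sub_softplus_neg x
    have h2 := key (-x) (by linarith)
    rw [max_eq_right hx, abs_le]
    constructor <;> linarith [Real.log_nonneg (one_le_two (α := ℝ))]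

theorem softplus_add_softplus_neg (x : ℝ) :
    softplus x + softplus (-x) = 2 * Real.log 2 + 2 * Real.log (Real.cosh (x / 2)) := by
  have hc := Real.cosh_pos (x / 2)
  unfold softplus
  rw [← Real.log_mul (by positivity) (by positivity)]
  have : (Real.exp x + 1) * (Real.exp (-x) + 1) = (2 * Real.cosh (x / 2)) ^ 2 := by
    have h1 : Real.exp x = Real.exp (x / 2) ^ 2 := by rw [← Real.exp_nat_mul]; congr 1; ring
    have h2 : Real.exp (-x) = Real.exp (-(x / 2)) ^ 2 := by
      rw [← Real.exp_nat_mul]; congr 1; push_cast; ring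
    have h3 : Real.exp (x / 2) * Real.exp (-(x / 2)) = 1 := by rw [← Real.exp_add]; simp
    rw [Real.cosh_eq, h1, h2]
    linear_combination (Real.exp (x / 2) * Real.exp (-(x / 2)) - 1) * h3
  rw [this, Real.log_pow, Real.log_mul (by norm_num) hc.ne']
  push_cast
  ring

/-- The lower bound combines `1 + x² / 2 ≤ cosh x`, `log t ≥ 1 - 1 / t` and `1 / (1 + a) ≤ 1 - a +
a²`. -/
theorem log_cosh_bounds (x : ℝ) :
    x ^ 2 / 2 - x ^ 4 / 4 ≤ Real.log (Real.cosh x) ∧ Real.log (Real.cosh x) ≤ x ^ 2 / 2 := by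
  have hc := Real.cosh_pos x
  constructor
  · have h1 : 1 + x ^ 2 / 2 ≤ Real.cosh x := by
      have := Real.cosh_sq (x / 2)
      have h2 := Real.cosh_two_mul (x / 2)
      have h3 : (x / 2) ^ 2 ≤ Real.sinh (x / 2) ^ 2 := by
        rw [sq_le_sq, Real.abs_sinh]
        exact Real.self_le_sinh_iff.2 (abs_nonneg _)
      rw [show 2 * (x / 2) = x by ring] at h2
      nlinarith
    have h2 := Real.one_sub_inv_le_log_of_pos hc
    have h3 : (Real.cosh x)⁻¹ ≤ (1 + x ^ 2 / 2)⁻¹ := inv_anti₀ (by positivity) h1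
    have h4 : (1 + x ^ 2 / 2)⁻¹ ≤ 1 - x ^ 2 / 2 + x ^ 4 / 4 := by
      rw [inv_le_iff_one_le_mul₀ (by positivity)]
      have : 0 ≤ x ^ 6 := by positivity
      nlinarith
    linarith
  · rw [Real.log_le_iff_le_exp hc]
    exact Real.cosh_le_exp_half_sq x

theorem id_mem_softplusLimits : id ∈ softplusLimits := by
  refine ⟨continuous_id, fun R δ hδ => ⟨0, ![1, -1, 0], ![1, -1, 0], 0, fun x _ => ?_⟩⟩
  have h := softplus_sub_softplus_neg x
  simp only [Fin.sum_univ_three, Matrix.cons_val_zero, Matrix.cons_val_one, Matrix.cons_val,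
    Pi.zero_apply, id, add_zero, one_mul, neg_mul, zero_mul, zero_add]
  rw [show x - (softplus x + -softplus (-x)) = 0 by linarith, abs_zero]
  exact hδ.le

/-- The even part of softplus is `log cosh` up to scaling and a constant, hence quadratic near 0.
Evaluated at `h x` and rescaled by `4 / h²`, it differs from `x²` by at most `h² x⁴ / 8`. -/
theorem sq_mem_softplusLimits : (fun x : ℝ => x ^ 2) ∈ softplusLimits := by
  refine ⟨by fun_prop, fun R δ hδ => ?_⟩
  obtain ⟨h, h0, hh⟩ : ∃ h : ℝ, 0 < h ∧ h ^ 2 * R ^ 4 ≤ δ := by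
    refine ⟨Real.sqrt (δ / (R ^ 4 + 1)), by positivity, ?_⟩
    rw [Real.sq_sqrt (by positivity), div_mul_eq_mul_div, div_le_iff₀ (by positivity)]
    nlinarith
  refine ⟨-(8 * Real.log 2) / h ^ 2, ![4 / h ^ 2, 4 / h ^ 2, 0], ![h, -h, 0], 0,
    fun x hx => ?_⟩
  have e := softplus_add_softplus_neg (h * x)
  obtain ⟨l1, l2⟩ := log_cosh_bounds (h * x / 2)
  simp only [Fin.sum_univ_three, Matrix.cons_val_zero, Matrix.cons_val_one, Matrix.cons_val,
    Pi.zero_apply, add_zero, neg_mul, zero_mul]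
  have e2 : -(8 * Real.log 2) / h ^ 2 + (4 / h ^ 2 * softplus (h * x) +
      4 / h ^ 2 * softplus (-(h * x))) = 8 * Real.log (Real.cosh (h * x / 2)) / h ^ 2 := by
    rw [← mul_add, e]
    field_simp
    ring
  have hh2 : 0 < h ^ 2 := by positivity
  have hx4 : x ^ 4 ≤ R ^ 4 := by
    have : |x| ^ 4 ≤ R ^ 4 := pow_le_pow_left₀ (abs_nonneg _) hx 4
    rwa [Even.pow_abs (by decide)] at this
  have u1 : 8 * Real.log (Real.cosh (h * x / 2)) / h ^ 2 ≤ x ^ 2 := by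
    rw [div_le_iff₀ hh2]
    nlinarith
  have u2 : x ^ 2 - δ ≤ 8 * Real.log (Real.cosh (h * x / 2)) / h ^ 2 := by
    rw [le_div_iff₀ hh2]
    have : h ^ 2 * x ^ 4 ≤ δ := (mul_le_mul_of_nonneg_left hx4 hh2.le).trans hh
    have h3 : h ^ 2 * (h ^ 2 * x ^ 4) ≤ h ^ 2 * δ := mul_le_mul_of_nonneg_left this hh2.le
    have h4 : 0 ≤ h ^ 4 * x ^ 4 := by positivity
    nlinarith
  rw [e2, abs_le]
  constructor <;> linarith

/-- Softplus differs from ReLU by at most `log 2`, so `softplus (M x) / M` differs from it by at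
most `log 2 / M`, uniformly in `x`. -/
theorem sum_max_mem_softplusLimits (a w e : Fin 3 → ℝ) :
    (fun x : ℝ => ∑ i, a i * max 0 (w i * x + e i)) ∈ softplusLimits := by
  refine ⟨by fun_prop, fun R δ hδ => ?_⟩
  set A : ℝ := ∑ i, |a i| with hA
  have hA0 : 0 ≤ A := Finset.sum_nonneg fun _ _ => abs_nonneg _
  have hl : 0 < Real.log 2 := Real.log_pos one_lt_two
  set M : ℝ := (A + 1) * Real.log 2 / δ with hM
  have hM0 : 0 < M := by positivity
  refine ⟨0, fun i => a i / M, fun i => M * w i, fun i => M * e i, fun x _ => ?_⟩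
  rw [zero_add, ← Finset.sum_sub_distrib]
  calc _ ≤ ∑ i, |a i * max 0 (w i * x + e i) - a i / M * softplus (M * w i * x + M * e i)| :=
        Finset.abs_sum_le_sum_abs _ _
    _ ≤ ∑ i, |a i| * (Real.log 2 / M) := by
        refine Finset.sum_le_sum fun i _ => ?_
        have h := abs_softplus_sub_max (M * (w i * x + e i))
        have h2 : max 0 (M * (w i * x + e i)) = M * max 0 (w i * x + e i) := by
          rw [mul_max_of_nonneg _ _ hM0.le, mul_zero]
        rw [h2] at h
        have h3 : a i * max 0 (w i * x + e i) - a i / M * softplus (M * w i * x + M * e i) =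
            -(a i * ((softplus (M * (w i * x + e i)) - M * max 0 (w i * x + e i)) / M)) := by
          rw [mul_add, mul_assoc]
          field_simp
          ring
        rw [h3, abs_neg, abs_mul, abs_div, abs_of_pos hM0]
        gcongr
    _ = A * (Real.log 2 / M) := by rw [← Finset.sum_mul]
    _ ≤ δ := by
        rw [hM, div_div_eq_mul_div, mul_comm (A + 1), ← div_div, mul_div_assoc',
          div_le_iff₀ (by positivity), mul_div_right_comm, div_self hl.ne']
        nlinarith

/-! ### Circuits of limit gates -/

/-- The functions in `G` can be computed from those in `P` with at most `n` edges. -/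
def Reach {X : Type} (P : Set (X → ℝ)) (n : ℕ) (G : Set (X → ℝ)) : Prop :=
  ∃ m ≤ n, ∃ Q, G ⊆ Q ∧ Builds softplusLimits P m Q

theorem Builds.union {X : Type} {𝒜 : Set (ℝ → ℝ)} {P Q P' : Set (X → ℝ)} {n : ℕ}
    (h : Builds 𝒜 P n Q) : Builds 𝒜 (P ∪ P') n (Q ∪ P') := by
  induction h with
  | init => exact Builds.init
  | gate _ hφ S hS w c ih =>
    rw [Set.insert_union]
    exact ih.gate hφ S (hS.trans Set.subset_union_left) w c

theorem Builds.trans {X : Type} {𝒜 : Set (ℝ → ℝ)} {P Q R : Set (X → ℝ)} {n m : ℕ}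
    (h : Builds 𝒜 P n Q) (h' : Builds 𝒜 Q m R) : Builds 𝒜 P (n + m) R := by
  induction h' with
  | init => exact h
  | gate _ hφ S hS w c ih => rw [← add_assoc]; exact ih.gate hφ S hS w c

namespace Reach

variable {X : Type} {P P' G G' H : Set (X → ℝ)} {n n' m : ℕ}

theorem of_subset (h : G ⊆ P) : Reach P 0 G := ⟨0, le_rfl, P, h, Builds.init⟩

theorem mono (h : Reach P n G) (hP : P ⊆ P') (hn : n ≤ n') (hG : G' ⊆ G) : Reach P' n' G' := by
  obtain ⟨m, hm, Q, hQ, hB⟩ := h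
  refine ⟨m, hm.trans hn, Q ∪ P', hG.trans (hQ.trans Set.subset_union_left), ?_⟩
  have := hB.union (P' := P')
  rwa [Set.union_eq_self_of_subset_left hP] at this

theorem trans (h : Reach P n G) (h' : Reach (P ∪ G) m H) : Reach P (n + m) (G ∪ H) := by
  obtain ⟨k, hk, Q, hQ, hB⟩ := h
  obtain ⟨l, hl, R, hR, hB'⟩ := h'
  have h1 := hB'.union (P' := Q)
  rw [Set.union_eq_self_of_subset_left (Set.union_subset hB.subset hQ)] at h1
  exact ⟨k + l, by omega, R ∪ Q, Set.union_subset (hQ.trans Set.subset_union_right)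
    (hR.trans Set.subset_union_left), hB.trans h1⟩

theorem union (h : Reach P n G) (h' : Reach P m H) : Reach P (n + m) (G ∪ H) :=
  h.trans (h'.mono Set.subset_union_left le_rfl subset_rfl)

theorem iUnion {J : Type} [Fintype J] {k : J → ℕ} {F : J → Set (X → ℝ)}
    (h : ∀ j, Reach P (k j) (F j)) : Reach P (∑ j, k j) (⋃ j, F j) := by
  classical
  have : ∀ A : Finset J, Reach P (∑ j ∈ A, k j) (⋃ j ∈ A, F j) := by
    intro A
    induction A using Finset.induction_on with
    | empty => simpa using of_subset (Set.empty_subset _)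
    | insert a A ha ih =>
      rw [Finset.sum_insert ha, Finset.set_biUnion_insert]
      exact (h a).union ih
  simpa using this Finset.univ

theorem gate {J : Type} [Fintype J] {φ : ℝ → ℝ} (hφ : φ ∈ softplusLimits) (u : J → X → ℝ)
    (hu : ∀ j, u j ∈ P) (a : J → ℝ) (c : ℝ) :
    Reach P (Fintype.card J) {fun s => φ (c + ∑ j, a j * u j s)} := by
  obtain ⟨S, w, hS, hc, hw⟩ := exists_finset_sum u a
  refine ⟨0 + S.card, by simpa using hc, _, ?_, Builds.init.gate hφ S
    (hS.trans (by rintro _ ⟨j, rfl⟩; exact hu j)) w c⟩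
  simp [hw]

theorem gate_one {φ : ℝ → ℝ} (hφ : φ ∈ softplusLimits) {u : X → ℝ} (hu : u ∈ P) (a c : ℝ) :
    Reach P 1 {fun s => φ (c + a * u s)} := by
  simpa using gate (J := Fin 1) hφ (fun _ => u) (fun _ => hu) (fun _ => a) c

theorem gate_two {φ : ℝ → ℝ} (hφ : φ ∈ softplusLimits) {u v : X → ℝ} (hu : u ∈ P) (hv : v ∈ P)
    (a b c : ℝ) : Reach P 2 {fun s => φ (c + (a * u s + b * v s))} := by
  simpa [Fin.sum_univ_two] using gate (J := Fin 2) hφ ![u, v]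
    (by simp [Fin.forall_fin_two, hu, hv]) ![a, b] c

theorem linear {J : Type} [Fintype J] (u : J → X → ℝ)
    (hu : ∀ j, u j ∈ P) (a : J → ℝ) (c : ℝ) :
    Reach P (Fintype.card J) {fun s => c + ∑ j, a j * u j s} :=
  gate id_mem_softplusLimits u hu a c

theorem linear_two {u v : X → ℝ} (hu : u ∈ P) (hv : v ∈ P) (a b c : ℝ) :
    Reach P 2 {fun s => c + (a * u s + b * v s)} :=
  gate_two id_mem_softplusLimits hu hv a b c

theorem linear_three {u v x : X → ℝ} (hu : u ∈ P) (hv : v ∈ P) (hx : x ∈ P) (a b c : ℝ) :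
    Reach P 3 {fun s => a * u s + b * v s + c * x s} := by
  simpa [Fin.sum_univ_three] using linear (J := Fin 3) ![u, v, x]
    (by simp [Fin.forall_fin_succ, hu, hv, hx]) ![a, b, c] 0

/-- Polarization: `u v = ((u + v)² - (u - v)²) / 4`, with three gates of two sources. -/
theorem mul {u v : X → ℝ} (hu : u ∈ P) (hv : v ∈ P) : Reach P 6 {fun s => u s * v s} := by
  have h1 := gate_two sq_mem_softplusLimits hu hv 1 1 0
  have h2 := gate_two sq_mem_softplusLimits hu hv 1 (-1) 0
  have h := (h1.union h2).trans (linear_two (u := fun s => (0 + (1 * u s + 1 * v s)) ^ 2)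
    (v := fun s => (0 + (1 * u s + -1 * v s)) ^ 2) (by simp) (by simp) (1 / 4) (-1 / 4) 0)
  refine h.mono subset_rfl le_rfl ?_
  rw [Set.singleton_subset_iff]
  refine Or.inr ?_
  rw [Set.mem_singleton_iff]
  funext s
  ring

/-- The indicator of a half-line, on finitely many arguments. -/
theorem step [Finite X] {u : X → ℝ} (hu : u ∈ P) :
    Reach P 1 {fun s => if 0 ≤ u s then 1 else 0} := by
  -- The finitely many negative values of `u` stay away from 0, so the ramp `max 0 (M' u + 1) - max
  -- 0 (M' u)` can be made steep enough to vanish on all of them.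
  obtain ⟨M, hM⟩ : ∃ M : ℝ, ∀ s, u s < 0 → M * u s + 1 ≤ 0 := by
    have : ∀ s, ∀ᶠ M : ℝ in Filter.atTop, u s < 0 → M * u s + 1 ≤ 0 := by
      intro s
      by_cases hs : u s < 0
      · filter_upwards [Filter.eventually_ge_atTop (-(u s)⁻¹)] with M hM _
        have : M * u s ≤ -(u s)⁻¹ * u s := mul_le_mul_of_nonpos_right hM hs.le
        rw [neg_mul, inv_mul_cancel₀ hs.ne] at this
        linarith
      · exact Filter.Eventually.of_forall fun _ h => absurd h hs
    exact (Filter.eventually_all.2 this).exists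
  set M' := max M 0
  have h := gate_one (sum_max_mem_softplusLimits ![1, -1, 0] ![M', M', 0] ![1, 0, 0]) hu 1 0
  convert h using 3 with s
  simp only [Fin.sum_univ_three, Matrix.cons_val_zero, Matrix.cons_val_one, Matrix.cons_val]
  have h0 : 0 ≤ M' := le_max_right _ _
  split_ifs with hs
  · have : 0 ≤ M' * u s := mul_nonneg h0 hs
    rw [max_eq_right (by linarith), max_eq_right (by linarith)]
    ring
  · have hs := not_le.1 hs
    have h2 : M' * u s + 1 ≤ 0 :=
      (add_le_add_left (mul_le_mul_of_nonpos_right (le_max_left M 0) hs.le) 1).trans (hM s hs)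
    rw [max_eq_left (by linarith), max_eq_left (by linarith)]
    ring

/-- The indicator of one value of a function with natural values. -/
theorem indicator {x : X → ℕ} (hx : (fun s => (x s : ℝ)) ∈ P) (k : ℕ) :
    Reach P 1 {fun s => if x s = k then 1 else 0} := by
  -- The hat function, a second difference of ReLU: it is 1 at 0 and vanishes at all other integers.
  have h := gate_one (sum_max_mem_softplusLimits ![1, -2, 1] ![1, 1, 1] ![1, 0, -1]) hx 1 (-k)
  convert h using 3 with s
  simp only [Fin.sum_univ_three, Matrix.cons_val_zero, Matrix.cons_val_one, Matrix.cons_val]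
  rcases lt_trichotomy (x s) k with hs | hs | hs
  · have : (x s : ℝ) + 1 ≤ k := by exact_mod_cast hs
    rw [if_neg hs.ne, max_eq_left (by linarith), max_eq_left (by linarith),
      max_eq_left (by linarith)]
    ring
  · rw [if_pos hs, hs, max_eq_right (by linarith), max_eq_left (by linarith),
      max_eq_left (by linarith)]
    ring
  · have : (k : ℝ) + 1 ≤ x s := by exact_mod_cast hs
    rw [if_neg hs.ne', max_eq_right (by linarith), max_eq_right (by linarith),
      max_eq_right (by linarith)]
    ring

end Reach

/-! ### Logarithm and argument by bisection -/

namespace Reach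

variable {X : Type} {P : Set (X → ℝ)}

theorem const (c : ℝ) : Reach P 0 {fun _ => c} := by
  simpa using linear (P := P) (J := Fin 0) (fun _ _ => 0) (fun j => j.elim0) (fun _ => 0) c

/-- The binary digits of `t / L`, when translations of `t` act linearly on the pair `(e, f)`
and the sign of `f` is that of its argument. -/
theorem bisect [Finite X] {t : X → ℝ} {L : ℝ} (hL0 : 0 < L) (ht : ∀ s, 0 ≤ t s ∧ t s < L) (e f : X → ℝ → ℝ)
    (hlin : ∀ θ : ℝ, ∃ a b c d : ℝ, ∀ s u, e s (u - θ) = a * e s u + b * f s u ∧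
      f s (u - θ) = c * e s u + d * f s u)
    (hsign : ∀ s u, -(L / 2) ≤ u → u < L / 2 → (0 ≤ f s u ↔ 0 ≤ u))
    (he : (fun s => e s (t s)) ∈ P) (hf : (fun s => f s (t s)) ∈ P) (n : ℕ) :
    ∃ l : X → ℝ, (∀ s, 0 ≤ t s - l s ∧ t s - l s < L / 2 ^ n) ∧
      Reach P (23 * n) {l, fun s => e s (t s - l s), fun s => f s (t s - l s)} := by
  induction n with
  | zero =>
    refine ⟨fun _ => 0, by simpa using ht, ?_⟩
    refine ((const 0).union (of_subset (G := P) subset_rfl)).mono subset_rfl le_rfl ?_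
    simp [Set.insert_subset_iff, he, hf]
  | succ n ih =>
    obtain ⟨l, hl, hr⟩ := ih
    set θ : ℝ := L / 2 ^ (n + 1) with hθ
    obtain ⟨a, b, c, d, habcd⟩ := hlin θ
    set E : X → ℝ := fun s => e s (t s - l s) with hE
    set F : X → ℝ := fun s => f s (t s - l s) with hF
    -- `D` is `f` at the remainder minus `θ`, so its sign decides whether the next digit `χ` is 1.
    -- The products `χ E` and `χ F` then perform the translation by `θ` only when it is. The edges
    -- of one round are 2 + 1 + 6 + 6 + 3 + 3 + 2 = 23.
    set D : X → ℝ := fun s => 0 + (c * E s + d * F s) with hD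
    set χ : X → ℝ := fun s => if 0 ≤ D s then 1 else 0 with hχ
    have r1 := hr.trans (linear_two (u := E) (v := F) (by simp) (by simp) c d 0)
    have r2 := r1.trans (step (u := D) (by simp [hD]))
    have r3 := r2.trans (mul (u := χ) (v := E) (by simp [hχ]) (by simp))
    have r4 := r3.trans (mul (u := χ) (v := F) (by simp [hχ]) (by simp))
    have r5 := r4.trans (linear_three (u := E) (v := fun s => χ s * E s) (x := fun s => χ s * F s)
      (by simp) (by simp) (by simp) 1 (a - 1) b)
    have r6 := r5.trans (linear_three (u := F) (v := fun s => χ s * E s) (x := fun s => χ s * F s)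
      (by simp) (by simp) (by simp) 1 c (d - 1))
    have r7 := r6.trans (linear_two (u := l) (v := χ) (by simp) (by simp [hχ]) 1 θ 0)
    have hθ0 : 0 < θ := by positivity
    have hθ2 : L / 2 ^ n = 2 * θ := by rw [hθ, pow_succ]; field_simp
    have hθle : θ ≤ L / 2 := by
      rw [hθ, pow_succ]
      refine div_le_div_of_nonneg_left hL0.le two_pos ?_
      have : (1 : ℝ) ≤ 2 ^ n := one_le_pow₀ one_le_two
      linarith
    have hχ' : ∀ s, χ s = if θ ≤ t s - l s then 1 else 0 := by
      intro s
      have h1 : D s = f s (t s - l s - θ) := by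
        rw [(habcd s _).2]
        exact zero_add _
      have h2 := hl s
      rw [hθ2] at h2
      have h3 := hsign s (t s - l s - θ) (by linarith) (by linarith)
      simp only [hχ, h1, h3, sub_nonneg]
    refine ⟨fun s => 0 + (1 * l s + θ * χ s), ?_, r7.mono subset_rfl (by omega) ?_⟩
    · intro s
      have h2 := hl s
      rw [hθ2] at h2
      beta_reduce
      rw [hχ' s]
      split_ifs with h
      · constructor <;> linarith
      · constructor <;> linarith
    · have hE' : (fun s => e s (t s - (0 + (1 * l s + θ * χ s)))) =
          fun s => 1 * E s + (a - 1) * (χ s * E s) + b * (χ s * F s) := by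
        funext s
        rw [hχ' s]
        split_ifs with h
        · rw [show t s - (0 + (1 * l s + θ * 1)) = t s - l s - θ by ring, (habcd s _).1]
          simp only [hE, hF]; ring
        · rw [show t s - (0 + (1 * l s + θ * 0)) = t s - l s by ring]
          simp only [hE]; ring
      have hF' : (fun s => f s (t s - (0 + (1 * l s + θ * χ s)))) =
          fun s => 1 * F s + c * (χ s * E s) + (d - 1) * (χ s * F s) := by
        funext s
        rw [hχ' s]
        split_ifs with h
        · rw [show t s - (0 + (1 * l s + θ * 1)) = t s - l s - θ by ring, (habcd s _).2]
          simp only [hE, hF]; ring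
        · rw [show t s - (0 + (1 * l s + θ * 0)) = t s - l s by ring]
          simp only [hF]; ring
      rw [hE', hF']
      simp [Set.insert_subset_iff]

/-- Bisection of `log y - A` with the pair `(1, exp u - 1)`: the initial second component is `exp
(-A) y - 1`, which is affine in `y`, so no logarithm is needed to start. -/
theorem log [Finite X] {y : X → ℝ} (hy : y ∈ P) (hpos : ∀ s, 0 < y s) {A L : ℝ} (hL0 : 0 < L)
    (hA : ∀ s, A ≤ Real.log (y s)) (hL : ∀ s, Real.log (y s) < A + L) (n : ℕ) :
    ∃ g : X → ℝ, (∀ s, |g s - Real.log (y s)| ≤ L / 2 ^ n) ∧ Reach P (23 * n + 2) {g} := by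
  have r := (gate_one (P := P) id_mem_softplusLimits hy (Real.exp (-A)) (-1)).union (const 1)
  obtain ⟨l, hl, hr⟩ := bisect (X := X) (t := fun s => Real.log (y s) - A) (L := L)
    (P := P ∪ ({fun s => id (-1 + Real.exp (-A) * y s)} ∪ {fun _ => 1})) hL0
    (fun s => ⟨by linarith [hA s], by linarith [hL s]⟩) (fun _ _ => 1)
    (fun _ u => Real.exp u - 1)
    (fun θ => ⟨1, 0, Real.exp (-θ) - 1, Real.exp (-θ), fun s u =>
      ⟨by ring, by rw [sub_eq_add_neg u, Real.exp_add]; ring⟩⟩)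
    (fun s u _ _ => by rw [sub_nonneg, Real.one_le_exp_iff]) (by simp) (by
      refine Or.inr (Or.inl ?_)
      rw [Set.mem_singleton_iff]
      funext s
      rw [sub_eq_add_neg (Real.log _), Real.exp_add, Real.exp_log (hpos s), id_eq]
      ring) n
  have r2 := (r.trans hr).trans (gate_one id_mem_softplusLimits (u := l) (by simp) 1 A)
  refine ⟨fun s => id (A + 1 * l s), fun s => ?_, r2.mono subset_rfl (by omega) (by simp)⟩
  have := hl s
  rw [abs_le]
  simp only [id_eq]
  constructor <;> linarith

/-- Multiplying `z` by the sign of its imaginary part moves it to the open upper half-plane, where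
the angle `t` lies in `[0, π)`. Bisection then uses the pair `(|z| cos u, |z| sin u)`, which
translations rotate; the sine has the sign of its argument on `[-π / 2, π / 2)`. In the end `π` is
subtracted where the sign was negative. -/
theorem arg [Finite X] {z : X → ℂ} (hx : (fun s => (z s).re) ∈ P) (hy : (fun s => (z s).im) ∈ P)
    (him : ∀ s, (z s).im ≠ 0) (n : ℕ) :
    ∃ g : X → ℝ, (∀ s, |g s - Complex.arg (z s)| ≤ Real.pi / 2 ^ n) ∧
      Reach P (23 * n + 16) {g} := by
  set χ : X → ℝ := fun s => if 0 ≤ (z s).im then 1 else 0 with hχ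
  have r1 := step hy
  have r2 := r1.trans (gate_one id_mem_softplusLimits (u := χ) (by simp [hχ]) 2 (-1))
  set σ : X → ℝ := fun s => id (-1 + 2 * χ s) with hσ
  have r3 := r2.trans (mul (u := σ) (v := fun s => (z s).re) (by simp [hσ]) (by simp [hx]))
  have r4 := r3.trans (mul (u := σ) (v := fun s => (z s).im) (by simp [hσ]) (by simp [hy]))
  set t : X → ℝ := fun s => Complex.arg (z s) + (1 - χ s) * Real.pi with ht
  have hcos : ∀ s, Real.cos (t s) = σ s * Real.cos (z s).arg := by
    intro s
    simp only [ht, hσ, hχ, id]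
    split_ifs
    · norm_num
    · rw [sub_zero, one_mul, Real.cos_add_pi]; ring
  have hsin : ∀ s, Real.sin (t s) = σ s * Real.sin (z s).arg := by
    intro s
    simp only [ht, hσ, hχ, id]
    split_ifs
    · norm_num
    · rw [sub_zero, one_mul, Real.sin_add_pi]; ring
  obtain ⟨l, hl, hr⟩ := bisect (X := X) (t := t) (L := Real.pi)
    (P := P ∪ {fun s => σ s * (z s).re, fun s => σ s * (z s).im}) Real.pi_pos
    (fun s => by
      simp only [ht, hχ]
      split_ifs with h
      · have h1 := Complex.arg_nonneg_iff.2 h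
        have h2 : (z s).arg < Real.pi := Complex.arg_lt_pi_iff.2 (Or.inr (him s))
        constructor <;> linarith
      · have h1 := Complex.arg_neg_iff.2 (not_le.1 h)
        have h2 := Complex.neg_pi_lt_arg (z s)
        constructor <;> linarith) (fun s u => ‖z s‖ * Real.cos u)
    (fun s u => ‖z s‖ * Real.sin u)
    (fun θ => ⟨Real.cos θ, Real.sin θ, -Real.sin θ, Real.cos θ, fun s u =>
      ⟨by rw [Real.cos_sub]; ring, by rw [Real.sin_sub]; ring⟩⟩)
    (fun s u h1 h2 => by
      have hz : 0 < ‖z s‖ := norm_pos_iff.2 fun h => him s (by simp [h])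
      rw [mul_nonneg_iff_of_pos_left hz]
      constructor
      · intro h
        by_contra hu
        have := Real.sin_neg_of_neg_of_neg_pi_lt (not_le.1 hu) (by linarith [Real.pi_pos])
        linarith
      · intro h
        exact Real.sin_nonneg_of_nonneg_of_le_pi h (by linarith [Real.pi_pos]))
    (by
      refine Or.inr (Or.inl ?_)
      funext s
      simp only [hcos, ← Complex.norm_mul_cos_arg (z s)]
      ring) (by
      refine Or.inr (Or.inr ?_)
      rw [Set.mem_singleton_iff]
      funext s
      simp only [hsin, ← Complex.norm_mul_sin_arg (z s)]
      ring) n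
  have r5 := (r4.trans (hr.mono (by
    refine Set.union_subset_union_right _ ?_
    simp [Set.insert_subset_iff]) le_rfl subset_rfl)).trans
    (linear_two (u := l) (v := χ) (by simp) (by simp [hχ]) 1 Real.pi (-Real.pi))
  refine ⟨_, fun s => ?_, r5.mono subset_rfl (by omega) Set.subset_union_right⟩
  have := hl s
  simp only [ht] at this
  rw [abs_le]
  constructor <;> linarith

end Reach

/-! ### Sums over some of the contracted indices -/

section BondSum

variable {n : ℕ} {χ : Fin n → ℕ}

/-- The sum of `f` over the values of the variables in `E`. -/
def bondSum (E : Finset (Fin n)) (f : (∀ e, Fin (χ e)) → ℂ) (β : ∀ e, Fin (χ e)) : ℂ :=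
  ∑ τ : (∀ e : E, Fin (χ e)), f (Function.updateFinset β E τ)

theorem bondSum_union {E E' : Finset (Fin n)} (h : Disjoint E E') (f : (∀ e, Fin (χ e)) → ℂ)
    (β : ∀ e, Fin (χ e)) : bondSum (E ∪ E') f β = bondSum E (bondSum E' f) β := by
  unfold bondSum
  rw [← (Equiv.piFinsetUnion (fun e => Fin (χ e)) h).sum_comp, Fintype.sum_prod_type]
  simp only [Function.updateFinset_updateFinset h]

/-- Distributivity: a sum over two independent groups of variables factors when each factor ignores
the other's group. -/
theorem bondSum_mul {E E' : Finset (Fin n)} (h : Disjoint E E') {f g : (∀ e, Fin (χ e)) → ℂ}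
    (hf : ∀ β τ, f (Function.updateFinset β E' τ) = f β)
    (hg : ∀ β τ, g (Function.updateFinset β E τ) = g β) (β : ∀ e, Fin (χ e)) :
    bondSum (E ∪ E') (fun β => f β * g β) β = bondSum E f β * bondSum E' g β := by
  rw [bondSum_union h]
  unfold bondSum
  rw [Finset.sum_mul_sum]
  refine Finset.sum_congr rfl fun τ _ => Finset.sum_congr rfl fun τ' _ => ?_
  beta_reduce
  rw [hf]
  congr 1
  have : Function.updateFinset (Function.updateFinset β E τ) E' τ' =
      Function.updateFinset (Function.updateFinset β E' τ') E τ := by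
    funext e
    simp only [Function.updateFinset]
    split_ifs with h1 h2
    · exact absurd h1 (Finset.disjoint_left.1 h h2)
    · rfl
    · rfl
    · rfl
  rw [this, hg]

theorem bondSum_univ (f : (∀ e, Fin (χ e)) → ℂ) (β : ∀ e, Fin (χ e)) :
    bondSum Finset.univ f β = ∑ β, f β := by
  unfold bondSum
  refine Fintype.sum_bijective (fun τ => Function.updateFinset β Finset.univ τ) ?_ _ _
    fun _ => rfl
  constructor
  · intro τ τ' h
    rw [← Function.restrict_updateFinset (s := Finset.univ) β τ,
      ← Function.restrict_updateFinset (s := Finset.univ) β τ']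
    exact congrArg _ h
  · exact fun τ => ⟨Finset.univ.restrict τ, Function.updateFinset_univ⟩

theorem card_bondValues (E : Finset (Fin n)) :
    Fintype.card (∀ e : E, Fin (χ e)) = ∏ e ∈ E, χ e := by
  simp only [Fintype.card_pi, Fintype.card_fin]
  exact Finset.prod_coe_sort E χ

end BondSum

/-! ### Partial contractions of sets of tensors -/

namespace TensorNetwork

variable {N : ℕ} {d : Fin N → ℕ} (T : TensorNetwork N d)

/-- The bonds all of whose ends are in `S`. -/
def innerBonds (S : Finset (Fin T.nodes)) : Finset (Fin T.bonds) :=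
  Finset.univ.filter fun e => ∀ v ∈ T.ends e, v ∈ S

/-- The product of the tensors in `S`. -/
def nodeProd (S : Finset (Fin T.nodes)) (s : (i : Fin N) → Fin (d i))
    (β : (e : Fin T.bonds) → Fin (T.bondDim e)) : ℂ :=
  ∏ v ∈ S, T.entry v (fun e => β e) (fun i => s i)

/-- The contraction of the tensors in `S`, as a function of the values of all bonds. -/
def contraction (S : Finset (Fin T.nodes)) (β : (e : Fin T.bonds) → Fin (T.bondDim e))
    (s : (i : Fin N) → Fin (d i)) : ℂ :=
  bondSum (T.innerBonds S) (T.nodeProd S s) β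

theorem nodeProd_congr {S : Finset (Fin T.nodes)} (s : (i : Fin N) → Fin (d i))
    {β β' : (e : Fin T.bonds) → Fin (T.bondDim e)}
    (h : ∀ e, (∃ v ∈ S, v ∈ T.ends e) → β e = β' e) :
    T.nodeProd S s β = T.nodeProd S s β' :=
  Finset.prod_congr rfl fun v hv => congrArg (T.entry v · _)
    (funext fun e => h e ⟨v, hv, e.2⟩)

/-- This is why a contraction, although written as a function of all bonds, has only as many
different values of its index as the open bonds allow. -/
theorem contraction_congr {S : Finset (Fin T.nodes)}
    {β β' : (e : Fin T.bonds) → Fin (T.bondDim e)} (h : ∀ e ∈ T.openBonds S, β e = β' e) :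
    T.contraction S β = T.contraction S β' := by
  funext s
  refine Finset.sum_congr rfl fun τ _ => T.nodeProd_congr s fun e he => ?_
  simp only [Function.updateFinset]
  split_ifs with hi
  · rfl
  · refine h e ?_
    simp only [innerBonds, Finset.mem_filter, Finset.mem_univ, true_and, not_forall] at hi
    obtain ⟨v, hv, hvS⟩ := hi
    simp only [openBonds, Finset.mem_filter, Finset.mem_univ, true_and]
    exact ⟨he, v, hvS, hv⟩

theorem contraction_univ (β : (e : Fin T.bonds) → Fin (T.bondDim e)) :
    T.contraction Finset.univ β = T.amplitude := by
  funext s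
  have : T.innerBonds Finset.univ = Finset.univ := by simp [innerBonds]
  rw [contraction, this, bondSum_univ]
  rfl

/-- The bonds that become inner when `L` and `R` are contracted with each other. -/
def sharedBonds (L R : Finset (Fin T.nodes)) : Finset (Fin T.bonds) :=
  T.innerBonds (L ∪ R) \ (T.innerBonds L ∪ T.innerBonds R)

theorem exists_mem_ends (e : Fin T.bonds) : ∃ v, v ∈ T.ends e := by
  induction h : T.ends e with
  | _ a b => exact ⟨a, by simp⟩

/-- The inner bonds of `L ∪ R` are those of `L`, those of `R` and the shared ones. Tensors in `L` do
not see the inner bonds of `R` and conversely, so for fixed shared bonds the sum factors. -/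
theorem contraction_union {L R : Finset (Fin T.nodes)} (h : Disjoint L R)
    (β : (e : Fin T.bonds) → Fin (T.bondDim e)) (s : (i : Fin N) → Fin (d i)) :
    T.contraction (L ∪ R) β s = bondSum (T.sharedBonds L R)
      (fun β => T.contraction L β s * T.contraction R β s) β := by
  have hsub : T.innerBonds L ∪ T.innerBonds R ⊆ T.innerBonds (L ∪ R) := by
    intro e he
    simp only [innerBonds, Finset.mem_union, Finset.mem_filter, Finset.mem_univ, true_and] at he ⊢
    rcases he with he | he
    · exact fun v hv => Or.inl (he v hv)
    · exact fun v hv => Or.inr (he v hv)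
  have hind : ∀ {A B : Finset (Fin T.nodes)}, Disjoint A B → ∀ β τ,
      T.nodeProd A s (Function.updateFinset β (T.innerBonds B) τ) = T.nodeProd A s β := by
    intro A B hAB β τ
    refine T.nodeProd_congr s fun e he => ?_
    obtain ⟨v, hv, hve⟩ := he
    have : e ∉ T.innerBonds B := by
      simp only [innerBonds, Finset.mem_filter, Finset.mem_univ, true_and]
      exact fun hB => Finset.disjoint_left.1 hAB hv (hB v hve)
    simp [Function.updateFinset, this]
  have hdis : Disjoint (T.innerBonds L) (T.innerBonds R) := by
    rw [Finset.disjoint_left]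
    intro e he he'
    simp only [innerBonds, Finset.mem_filter, Finset.mem_univ, true_and] at he he'
    obtain ⟨v, hv⟩ := T.exists_mem_ends e
    exact Finset.disjoint_left.1 h (he v hv) (he' v hv)
  have hprod : T.nodeProd (L ∪ R) s = fun β => T.nodeProd L s β * T.nodeProd R s β :=
    funext fun β => Finset.prod_union h
  rw [contraction, ← Finset.sdiff_union_of_subset hsub, bondSum_union Finset.sdiff_disjoint, hprod]
  congr 1
  funext β
  exact bondSum_mul hdis (hind h) (hind h.symm) β

/-- The open bonds of the union and the shared bonds are disjoint and all open for `L` or for `R`.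
So the additions of a pairwise contraction are paid for by its run-time. -/
theorem prod_openBonds_union_mul_le {L R : Finset (Fin T.nodes)} (h : ∀ e, 1 ≤ T.bondDim e) :
    (∏ e ∈ T.openBonds (L ∪ R), T.bondDim e) * ∏ e ∈ T.sharedBonds L R, T.bondDim e ≤
      ∏ e ∈ T.openBonds L ∪ T.openBonds R, T.bondDim e := by
  rw [← Finset.prod_union]
  · refine Finset.prod_le_prod_of_subset_of_one_le' ?_ fun e _ _ => h e
    intro e he
    simp only [openBonds, sharedBonds, innerBonds, Finset.mem_union, Finset.mem_filter,
      Finset.mem_univ, true_and, Finset.mem_sdiff, not_or, not_forall] at he ⊢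
    rcases he with ⟨⟨v, hv, hve⟩, w, hw, hwe⟩ | ⟨h1, ⟨v, hve, hv⟩, w, hwe, hw⟩
    · rcases hv with hv | hv
      · exact Or.inl ⟨⟨v, hv, hve⟩, w, hw.1, hwe⟩
      · exact Or.inr ⟨⟨v, hv, hve⟩, w, hw.2, hwe⟩
    · exact Or.inl ⟨⟨w, (h1 w hwe).resolve_right hw, hwe⟩, v, hv, hve⟩
  · rw [Finset.disjoint_left]
    intro e he he'
    simp only [openBonds, sharedBonds, innerBonds, Finset.mem_filter, Finset.mem_univ, true_and,
      Finset.mem_sdiff] at he he'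
    obtain ⟨_, w, hw, hwe⟩ := he
    exact hw (he'.1 w hwe)

end TensorNetwork

/-! ### Contractions by neural networks -/

/-- The real and imaginary parts of a complex function. -/
def reIm {X : Type} (f : X → ℂ) : Set (X → ℝ) := {fun s => (f s).re, fun s => (f s).im}

theorem Reach.mul_complex {X : Type} {P : Set (X → ℝ)} {u v : X → ℂ} (hu : reIm u ⊆ P)
    (hv : reIm v ⊆ P) : Reach P 28 (reIm fun s => u s * v s) := by
  simp only [reIm, Set.insert_subset_iff, Set.singleton_subset_iff] at hu hv
  have r := (((Reach.mul hu.1 hv.1).union (Reach.mul hu.2 hv.2)).union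
    (Reach.mul hu.1 hv.2)).union (Reach.mul hu.2 hv.1)
  have r2 := (r.trans (Reach.linear_two (u := fun s => (u s).re * (v s).re)
    (v := fun s => (u s).im * (v s).im) (by simp) (by simp) 1 (-1) 0)).trans
    (Reach.linear_two (u := fun s => (u s).re * (v s).im)
    (v := fun s => (u s).im * (v s).re) (by simp) (by simp) 1 1 0)
  refine r2.mono subset_rfl le_rfl ?_
  simp only [reIm, Set.insert_subset_iff, Set.singleton_subset_iff]
  constructor
  · refine Or.inl (Or.inr ?_)
    rw [Set.mem_singleton_iff]
    funext s
    rw [Complex.mul_re]; ring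
  · refine Or.inr ?_
    rw [Set.mem_singleton_iff]
    funext s
    rw [Complex.mul_im]; ring

theorem Reach.sum_complex {X J : Type} [Fintype J] {P : Set (X → ℝ)} {u : J → X → ℂ}
    (hu : ∀ j, reIm (u j) ⊆ P) : Reach P (2 * Fintype.card J) (reIm fun s => ∑ j, u j s) := by
  simp only [reIm, Set.insert_subset_iff, Set.singleton_subset_iff] at hu
  have r := (Reach.linear (fun j s => (u j s).re) (fun j => (hu j).1) (fun _ => 1) 0).union
    (Reach.linear (fun j s => (u j s).im) (fun j => (hu j).2) (fun _ => 1) 0)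
  refine r.mono subset_rfl (by omega) ?_
  simp [reIm, Set.insert_subset_iff]

namespace TensorNetwork

variable {N : ℕ} {d : Fin N → ℕ} (T : TensorNetwork N d)

/-- One complex product (28 edges) for each joint value of the legs, then one sum over the shared
bonds for each value of the remaining legs. Each summand costs 2 edges, so the sums add at most 2
per joint value, which gives 30. The reference point `β₀` fixes the irrelevant bonds. -/
theorem reach_contraction_union {L R : Finset (Fin T.nodes)} (h : Disjoint L R)
    (β₀ : (e : Fin T.bonds) → Fin (T.bondDim e)) :
    Reach ((⋃ β, reIm (T.contraction L β)) ∪ ⋃ β, reIm (T.contraction R β))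
      (30 * ∏ e ∈ T.openBonds L ∪ T.openBonds R, T.bondDim e)
      (⋃ β, reIm (T.contraction (L ∪ R) β)) := by
  have hdim : ∀ e, 1 ≤ T.bondDim e := fun e => (β₀ e).pos
  set U := T.openBonds L ∪ T.openBonds R with hU
  set O := T.openBonds (L ∪ R) with hO
  have r1 := Reach.iUnion fun τ : (∀ e : U, Fin (T.bondDim e)) => Reach.mul_complex
    (P := (⋃ β, reIm (T.contraction L β)) ∪ ⋃ β, reIm (T.contraction R β))
    (u := T.contraction L (Function.updateFinset β₀ U τ))
    (v := T.contraction R (Function.updateFinset β₀ U τ))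
    ((Set.subset_iUnion (fun β => reIm (T.contraction L β)) _).trans Set.subset_union_left)
    ((Set.subset_iUnion (fun β => reIm (T.contraction R β)) _).trans Set.subset_union_right)
  have hprod : ∀ β, reIm (fun s => T.contraction L β s * T.contraction R β s) ⊆
      ⋃ τ : (∀ e : U, Fin (T.bondDim e)),
        reIm (fun s => T.contraction L (Function.updateFinset β₀ U τ) s *
          T.contraction R (Function.updateFinset β₀ U τ) s) := by
    intro β
    have key : ∀ e ∈ U, β e = Function.updateFinset β₀ U (U.restrict β) e := by
      intro e he
      simp [Function.updateFinset, he]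
    rw [T.contraction_congr (S := L) (fun e he => key e (Finset.mem_union_left _ he)),
      T.contraction_congr (S := R) (fun e he => key e (Finset.mem_union_right _ he))]
    exact Set.subset_iUnion (fun τ : (∀ e : U, Fin (T.bondDim e)) =>
      reIm (fun s => T.contraction L (Function.updateFinset β₀ U τ) s *
          T.contraction R (Function.updateFinset β₀ U τ) s)) (U.restrict β)
  have r2 := r1.trans (Reach.iUnion fun γ : (∀ e : O, Fin (T.bondDim e)) =>
    Reach.sum_complex (J := ∀ e : T.sharedBonds L R, Fin (T.bondDim e))
      (u := fun τ s => T.contraction L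
        (Function.updateFinset (Function.updateFinset β₀ O γ) (T.sharedBonds L R) τ) s *
        T.contraction R
        (Function.updateFinset (Function.updateFinset β₀ O γ) (T.sharedBonds L R) τ) s)
      (fun τ => (hprod _).trans Set.subset_union_right))
  refine r2.mono subset_rfl ?_ ?_
  · simp only [Finset.sum_const, Finset.card_univ, card_bondValues, smul_eq_mul]
    have := T.prod_openBonds_union_mul_le (L := L) (R := R) hdim
    rw [← hU, ← hO] at this
    nlinarith
  · refine Set.iUnion_subset fun β => Set.subset_union_of_subset_right ?_ _
    have key : ∀ e ∈ O, β e = Function.updateFinset β₀ O (O.restrict β) e := by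
      intro e he
      simp [Function.updateFinset, he]
    rw [T.contraction_congr key]
    refine Set.subset_iUnion_of_subset (O.restrict β) ?_
    rw [show T.contraction (L ∪ R) (Function.updateFinset β₀ O (O.restrict β)) = _ from
      funext (T.contraction_union h _)]
    exact subset_rfl

end TensorNetwork

/-! ### Functions of few degrees of freedom -/

theorem Finset.sum_le_prod_of_two_le {ι : Type} (A : Finset ι) (f : ι → ℕ)
    (h : ∀ i ∈ A, 2 ≤ f i) : ∑ i ∈ A, f i ≤ ∏ i ∈ A, f i := by
  classical
  induction A using Finset.induction_on with
  | empty => simp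
  | insert a A ha ih =>
    rw [Finset.sum_insert ha, Finset.prod_insert ha]
    have h1 := ih fun i hi => h i (Finset.mem_insert_of_mem hi)
    have h2 := h a (Finset.mem_insert_self _ _)
    rcases A.eq_empty_or_nonempty with rfl | ⟨b, hb⟩
    · simp
    · have h3 : 2 ≤ ∑ i ∈ A, f i := (h b (Finset.mem_insert_of_mem hb)).trans
        (Finset.single_le_sum (fun _ _ => Nat.zero_le _) hb)
      nlinarith

section Local

variable {N : ℕ} {d : Fin N → ℕ}

/-- The inputs of the neural network. -/
def inputs (d : Fin N → ℕ) : Set (((i : Fin N) → Fin (d i)) → ℝ) :=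
  Set.range fun p s => indicatorInput s p

/-- A number that determines the values of some of the degrees of freedom. -/
noncomputable def code (p : Fin N → Prop) [DecidablePred p] (σ : (i : {i // p i}) → Fin (d i)) : ℕ :=
  ∑ i ∈ (Finset.univ : Finset {i // p i}) with 2 ≤ d i.1,
    2 ^ (Fintype.equivFin (Σ i, Fin (d i)) ⟨i.1, σ i⟩ : ℕ)

/-- Each pair of a site and a value has its own power of two, so the code is the binary encoding of
a set of pairs. Sites with a single value carry no information and are left out. -/
theorem code_injective (p : Fin N → Prop) [DecidablePred p] :
    Function.Injective (code (d := d) p) := by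
  intro σ σ' h
  set q : ((i : {i // p i}) → Fin (d i)) → {i // p i} → ℕ :=
    fun σ i => (Fintype.equivFin (Σ i, Fin (d i)) ⟨i, σ i⟩ : ℕ) with hq
  have hinj : ∀ σ σ' i j, q σ i = q σ' j → (⟨i, σ i⟩ : Σ i : Fin N, Fin (d i)) = ⟨j, σ' j⟩ :=
    fun σ σ' i j h => (Fintype.equivFin _).injective (Fin.ext h)
  have hsum : ∀ σ, code p σ =
      ∑ k ∈ (Finset.univ.filter fun i : {i // p i} => 2 ≤ d i).image (q σ), 2 ^ k := by
    intro σ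
    rw [Finset.sum_image]
    · rfl
    · intro i _ j _ hij
      exact Subtype.ext (congrArg Sigma.fst (hinj _ _ _ _ hij))
  rw [hsum, hsum] at h
  have h := Finset.geomSum_injective le_rfl h
  funext i
  by_cases hi : 2 ≤ d i
  · have : q σ i ∈ (Finset.univ.filter fun i : {i // p i} => 2 ≤ d i).image (q σ') := by
      rw [← h]
      exact Finset.mem_image_of_mem _ (by simp [hi])
    obtain ⟨j, _, hj⟩ := Finset.mem_image.1 this
    have h1 := hinj _ _ _ _ hj
    obtain rfl : j = i := Subtype.ext (congrArg Sigma.fst h1)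
    simpa using h1.symm
  · have : Subsingleton (Fin (d i)) := Fin.subsingleton_iff_le_one.2 (by omega)
    exact Subsingleton.elim _ _

/-- The code is linear in the indicator inputs and uses `∑ d i` of them. Only sites with at least
two values contribute, so the sum is at most the product of all `d i`. -/
theorem reach_code (p : Fin N → Prop) [DecidablePred p] (hd : ∀ i, 1 ≤ d i) :
    Reach (inputs d) (∏ i : {i // p i}, d i) {fun s => (code (d := d) p (fun i => s i) : ℝ)} := by
  have r := Reach.linear (P := inputs d)
    (J := Σ i : {i : {i // p i} // 2 ≤ d i}, Fin (d i))
    (fun j s => indicatorInput s ⟨j.1.1, j.2⟩) (fun j => ⟨⟨j.1.1, j.2⟩, rfl⟩)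
    (fun j => 2 ^ (Fintype.equivFin (Σ i, Fin (d i)) ⟨j.1.1, j.2⟩ : ℕ)) 0
  refine r.mono subset_rfl ?_ ?_
  · rw [Fintype.card_sigma]
    simp only [Fintype.card_fin]
    rw [← Finset.sum_subtype (Finset.univ.filter fun i : {i // p i} => 2 ≤ d i) (by simp)
      (fun i => d i)]
    refine (Finset.sum_le_prod_of_two_le _ _ (by simp)).trans ?_
    exact Finset.prod_le_prod_of_subset_of_one_le' (Finset.filter_subset _ _) fun i _ _ => hd i
  · rw [Set.singleton_subset_iff, Set.mem_singleton_iff]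
    funext s
    rw [zero_add, Fintype.sum_sigma, code]
    push_cast
    rw [Finset.sum_subtype (p := fun i : {i // p i} => 2 ≤ d i)
      (Finset.univ.filter fun i : {i // p i} => 2 ≤ d i) (by simp)]
    refine Finset.sum_congr rfl fun i _ => ?_
    simp [indicatorInput]

/-- Functions of the degrees of freedom that satisfy `p`. -/
theorem reach_local (p : Fin N → Prop) [DecidablePred p] (hd : ∀ i, 1 ≤ d i) {K : Type} [Fintype K]
    (F : K → ((i : {i // p i}) → Fin (d i)) → ℝ) :
    Reach (inputs d) ((2 + Fintype.card K) * ∏ i : {i // p i}, d i)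
      (⋃ k, {fun s => F k (fun i => s i)}) := by
  set x : ((i : Fin N) → Fin (d i)) → ℕ := fun s => code (d := d) p (fun i => s i) with hx
  set χ : ((i : {i // p i}) → Fin (d i)) → ((i : Fin N) → Fin (d i)) → ℝ :=
    fun σ s => if x s = code p σ then 1 else 0 with hχ
  have hxmem : (fun s => (x s : ℝ)) ∈ inputs d ∪ {fun s => (x s : ℝ)} :=
    Or.inr (Set.mem_singleton _)
  -- Reading off a joint value from the single number `x` takes one edge, however many sites are
  -- involved; every local function is then linear in these indicators.
  have r1 := Reach.iUnion fun σ : ((i : {i // p i}) → Fin (d i)) =>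
    Reach.indicator hxmem (code p σ)
  have hmem : ∀ σ, χ σ ∈ ⋃ σ, {χ σ} := fun σ => Set.mem_iUnion.2 ⟨σ, Set.mem_singleton _⟩
  have r2 : Reach (⋃ σ, {χ σ}) _ (⋃ k, {fun s => 0 + ∑ σ, F k σ * χ σ s}) :=
    Reach.iUnion fun k : K => Reach.linear χ hmem (F k) 0
  have r := ((reach_code (d := d) p hd).trans r1).trans
    (r2.mono (Set.subset_union_right.trans Set.subset_union_right) le_rfl subset_rfl)
  have hcard : Fintype.card ((i : {i // p i}) → Fin (d i)) = ∏ i : {i // p i}, d i := by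
    simp only [Fintype.card_pi, Fintype.card_fin]
  refine r.mono subset_rfl ?_ ?_
  · simp only [Finset.sum_const, Finset.card_univ, hcard, smul_eq_mul]
    exact le_of_eq (by ring)
  · refine Set.subset_union_of_subset_right (Set.iUnion_mono fun k => ?_) _
    rw [Set.singleton_subset_iff, Set.mem_singleton_iff]
    funext s
    simp only [hχ, hx, (code_injective (d := d) p).eq_iff, mul_ite, mul_one, mul_zero,
      Finset.sum_ite_eq, Finset.mem_univ, if_true, zero_add]

end Local

namespace TensorNetwork

variable {N : ℕ} {d : Fin N → ℕ} (T : TensorNetwork N d)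

theorem reach_contraction_singleton (v : Fin T.nodes) (hd : ∀ i, 1 ≤ d i)
    (β₀ : (e : Fin T.bonds) → Fin (T.bondDim e)) :
    Reach (inputs d) (4 * T.tensorSize v) (⋃ β, reIm (T.contraction {v} β)) := by
  set O := T.openBonds {v} with hO
  set H : (∀ e : O, Fin (T.bondDim e)) → ((i : {i // T.site i = v}) → Fin (d i)) → ℂ :=
    fun γ σ => bondSum (T.innerBonds {v}) (fun β => T.entry v (fun e => β e) σ)
      (Function.updateFinset β₀ O γ) with hH
  have r := reach_local (d := d) (fun i => T.site i = v) hd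
    -- Real and imaginary parts for each value of the open legs; partial traces over loops at `v`
    -- are already performed in the table `H`.
    (K := (∀ e : O, Fin (T.bondDim e)) ⊕ (∀ e : O, Fin (T.bondDim e)))
    (Sum.elim (fun γ σ => (H γ σ).re) (fun γ σ => (H γ σ).im))
  have hle : ∏ e ∈ O, T.bondDim e ≤ ∏ e : {e // v ∈ T.ends e}, T.bondDim e := by
    rw [← Finset.prod_subtype (Finset.univ.filter fun e => v ∈ T.ends e) (by simp)]
    refine Finset.prod_le_prod_of_subset_of_one_le' ?_ fun e _ _ => (β₀ e).pos
    intro e he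
    simp only [hO, openBonds, Finset.mem_filter, Finset.mem_univ, true_and,
      Finset.mem_singleton, exists_eq_left] at he ⊢
    exact he.1
  have hpos : 1 ≤ ∏ e : {e // v ∈ T.ends e}, T.bondDim e :=
    Finset.one_le_prod' fun e _ => (β₀ e).pos
  refine r.mono subset_rfl ?_ ?_
  · rw [Fintype.card_sum, card_bondValues, tensorSize, ← mul_assoc]
    exact Nat.mul_le_mul_right _ (by omega)
  · refine Set.iUnion_subset fun β => ?_
    have key : ∀ e ∈ O, β e = Function.updateFinset β₀ O (O.restrict β) e := by
      intro e he
      simp [Function.updateFinset, he]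
    rw [T.contraction_congr key]
    have : T.contraction {v} (Function.updateFinset β₀ O (O.restrict β)) =
        fun s => H (O.restrict β) (fun i => s i) := by
      funext s
      simp only [contraction, hH]
      congr 1
      funext β
      exact Finset.prod_singleton _ _
    rw [this, reIm, Set.insert_subset_iff, Set.singleton_subset_iff]
    exact ⟨Set.mem_iUnion.2 ⟨Sum.inl (O.restrict β), rfl⟩,
      Set.mem_iUnion.2 ⟨Sum.inr (O.restrict β), rfl⟩⟩

theorem reach_contraction (hd : ∀ i, 1 ≤ d i) (β₀ : (e : Fin T.bonds) → Fin (T.bondDim e))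
    (t : ContractionTree T.nodes) (ht : t.leaves.Nodup) :
    Reach (inputs d) (30 * T.cost t) (⋃ β, reIm (T.contraction t.leaves.toFinset β)) := by
  induction t with
  | tensor v =>
    have := T.reach_contraction_singleton v hd β₀
    refine this.mono subset_rfl ?_ ?_
    · simp only [cost]; omega
    · simp [ContractionTree.leaves]
  | contract l r ihl ihr =>
    rw [ContractionTree.leaves, List.nodup_append'] at ht
    have hdis : Disjoint l.leaves.toFinset r.leaves.toFinset :=
      List.disjoint_toFinset_iff_disjoint.2 ht.2.2
    have h := ((ihl ht.1).union (ihr ht.2.1)).trans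
      ((T.reach_contraction_union hdis β₀).mono Set.subset_union_right le_rfl subset_rfl)
    refine h.mono subset_rfl ?_ ?_
    · simp only [cost]; ring_nf; exact le_rfl
    · rw [ContractionTree.leaves, List.toFinset_append]
      exact Set.subset_union_right

theorem one_le_cost (hd : ∀ i, 1 ≤ d i) (hb : ∀ e, 1 ≤ T.bondDim e)
    (t : ContractionTree T.nodes) : 1 ≤ T.cost t := by
  induction t with
  | tensor v =>
    exact Nat.mul_pos (Finset.prod_pos fun e _ => hb e) (Finset.prod_pos fun i _ => hd i)
  | contract l r ihl ihr => simp only [cost]; omega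

theorem reach_amplitude (hd : ∀ i, 1 ≤ d i) (β₀ : (e : Fin T.bonds) → Fin (T.bondDim e))
    (S : ContractionScheme T) : Reach (inputs d) (30 * S.runTime) (reIm T.amplitude) := by
  have h := T.reach_contraction hd β₀ S.tree
    (List.nodup_iff_count_le_one.2 fun v => (S.each_once v).le)
  refine h.mono subset_rfl le_rfl ?_
  have : S.tree.leaves.toFinset = Finset.univ := by
    ext v
    simp only [List.mem_toFinset, Finset.mem_univ, iff_true]
    exact List.count_pos_iff.1 (by rw [S.each_once v]; exact one_pos)
  rw [this]
  refine Set.subset_iUnion_of_subset β₀ ?_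
  rw [T.contraction_univ]

end TensorNetwork

/-! ### The complex logarithm of the amplitude and the final count -/

theorem NeuralNetwork.exists_of_isEmpty {N : ℕ} {d : Fin N → ℕ}
    [IsEmpty ((i : Fin N) → Fin (d i))] (f : ((i : Fin N) → Fin (d i)) → ℂ) (ε : ℝ) :
    ∃ net : NeuralNetwork (Σ i : Fin N, Fin (d i)),
      (∀ s, ‖net.output (indicatorInput s) - f s‖ < ε) ∧ net.edges.card = 0 := by
  refine ⟨{
    size := 2
    edges := ∅
    acyclic := fun _ _ h => absurd h (Finset.notMem_empty _)
    weight := fun _ _ => 0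
    bias := fun _ => 0
    root := id
    root_injective := Function.injective_id
    root_isRoot := fun _ _ => Finset.notMem_empty _
    linear := ∅
    linear_subset := fun _ h => absurd h (Finset.notMem_empty _) }, fun s => isEmptyElim s, rfl⟩

/-- Two functions that can be computed with limits of softplus neurons are, after rescaling,
approximated by the outputs of a neural network. -/
theorem Reach.exists_neuralNetwork {X ι : Type} [Finite X] [Fintype ι] {inp : ι → X → ℝ} {n : ℕ}
    {g : Fin 2 → X → ℝ} (h : Reach (Set.range inp) n {g 0, g 1}) (κ : Fin 2 → ℝ) {δ : ℝ}
    (hδ : 0 < δ) : ∃ net : NeuralNetwork ι, net.edges.card ≤ 9 * n + 6 ∧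
      ∀ s j, |net.value (fun i => inp i s) (net.root j) - κ j * g j s| ≤ |κ j| * δ := by
  obtain ⟨m, hm, Q, hQ, hB⟩ := h
  obtain ⟨m', Q', hm', hB', happ⟩ := hB.simulate δ hδ
  have hg : ∀ j, g j ∈ Q := by
    simp only [Set.insert_subset_iff, Set.singleton_subset_iff] at hQ
    exact Fin.forall_fin_two.2 hQ
  choose c a u hu happ using fun j => happ (g j) (hg j)
  choose S w hS hcard hsum using fun j => exists_finset_sum (u j) (fun i => κ j * a j i)
  obtain ⟨net, hnet, hval⟩ := hB'.exists_neuralNetwork inp S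
    (fun j => (hS j).trans (by rintro _ ⟨i, rfl⟩; exact hu j i)) w (fun j => κ j * c j)
  refine ⟨net, ?_, fun s j => ?_⟩
  · have h0 := hcard 0
    have h1 := hcard 1
    simp only [Fintype.card_fin] at h0 h1
    omega
  · rw [hval, hsum]
    have : κ j * c j + ∑ i, κ j * a j i * u j i s - κ j * g j s =
        -(κ j * (g j s - (c j + ∑ i, a j i * u j i s))) := by
      simp only [mul_assoc, ← Finset.mul_sum]
      ring
    rw [this, abs_neg, abs_mul]
    exact mul_le_mul_of_nonneg_left (happ j s) (abs_nonneg _)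

theorem InBitRange.sq_bounds {b : ℕ} {x : ℝ} (h : InBitRange b x) (hx : x ≠ 0) :
    ((2 : ℝ) ^ (2 * b))⁻¹ ≤ x ^ 2 ∧ x ^ 2 ≤ 2 ^ (2 * b) := by
  obtain ⟨h1, h2⟩ := h.resolve_left hx
  have e : (2 : ℝ) ^ (2 * b) = (2 ^ b) ^ 2 := by rw [mul_comm, pow_mul]
  rw [e, ← inv_pow, ← sq_abs x]
  exact ⟨pow_le_pow_left₀ (by positivity) h1 2, pow_le_pow_left₀ (abs_nonneg _) h2 2⟩

/-- The complex logarithm of a function whose values have `b` bits of precision. -/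
theorem Reach.clog {X : Type} [Finite X] {P : Set (X → ℝ)} {z : X → ℂ} (hz : reIm z ⊆ P) {b : ℕ}
    (hb : 1 ≤ b) (hre : ∀ s, InBitRange b (z s).re) (him : ∀ s, InBitRange b (z s).im)
    (hre0 : ∀ s, (z s).re ≠ 0) (him0 : ∀ s, (z s).im ≠ 0) (n : ℕ) :
    ∃ g : Fin 2 → X → ℝ, (∀ s, |1 / 2 * g 0 s - (Complex.log (z s)).re| ≤ 3 * b / 2 ^ n) ∧
      (∀ s, |g 1 s - (Complex.log (z s)).im| ≤ 4 / 2 ^ n) ∧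
      Reach P (46 * n + 22) {g 0, g 1} := by
  simp only [reIm, Set.insert_subset_iff, Set.singleton_subset_iff] at hz
  obtain ⟨g₁, hg₁, r₁⟩ := Reach.arg hz.1 hz.2 him0 n
  have r₂ := (gate_one sq_mem_softplusLimits hz.1 1 0).union
    (gate_one sq_mem_softplusLimits hz.2 1 0)
  have r₃ := r₂.trans (linear_two (u := fun s => (0 + 1 * (z s).re) ^ 2)
    (v := fun s => (0 + 1 * (z s).im) ^ 2) (by simp) (by simp) 1 1 0)
  set y : X → ℝ := fun s => 0 + (1 * (0 + 1 * (z s).re) ^ 2 + 1 * (0 + 1 * (z s).im) ^ 2) with hy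
  have hyz : ∀ s, y s = (z s).re ^ 2 + (z s).im ^ 2 := fun s => by simp only [hy]; ring
  have hl2 : 0 < Real.log 2 := Real.log_pos one_lt_two
  have hb' : (1 : ℝ) ≤ b := by exact_mod_cast hb
  have hpos : ∀ s, 0 < y s := fun s => by
    rw [hyz]
    have := pow_pos (abs_pos.2 (hre0 s)) 2
    rw [sq_abs] at this
    positivity
  obtain ⟨g₀, hg₀, r₀⟩ := Reach.log (P := P ∪ {y}) (y := y) (by simp) hpos
    -- Here `2 ^ (-2 b) ≤ |z|² ≤ 2 ^ (2 b + 1)`; one more factor 2 in the range makes the upper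
    -- inequality strict.
    (A := -(2 * b * Real.log 2)) (L := (4 * b + 2) * Real.log 2) (by positivity)
    (fun s => by
      have h1 : ((2 : ℝ) ^ (2 * b))⁻¹ ≤ y s := by
        rw [hyz]
        have := ((hre s).sq_bounds (hre0 s)).1
        nlinarith [sq_nonneg (z s).im]
      have h2 := Real.log_le_log (by positivity) h1
      rw [Real.log_inv, Real.log_pow] at h2
      push_cast at h2
      linarith)
    (fun s => by
      have h1 : y s ≤ (2 : ℝ) ^ (2 * b + 1) := by
        rw [hyz, pow_succ (2 : ℝ)]
        linarith [((hre s).sq_bounds (hre0 s)).2, ((him s).sq_bounds (him0 s)).2]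
      have h2 := Real.log_le_log (hpos s) h1
      rw [Real.log_pow] at h2
      push_cast at h2
      linarith) n
  have r₄ := r₃.trans (r₀.mono (Set.union_subset_union_right _ (by simp [hy])) le_rfl subset_rfl)
  refine ⟨![g₀, g₁], fun s => ?_, fun s => ?_, ?_⟩
  · have h1 : (Complex.log (z s)).re = 1 / 2 * Real.log (y s) := by
      have : y s = ‖z s‖ ^ 2 := by rw [hyz, Complex.sq_norm, Complex.normSq_apply]; ring
      rw [Complex.log_re, this, Real.log_pow]
      push_cast
      ring
    have h2 : (4 * b + 2) * Real.log 2 ≤ 6 * (b : ℝ) := by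
      have := Real.log_two_lt_d9
      nlinarith
    have h3 : (4 * b + 2) * Real.log 2 / 2 ^ n ≤ 6 * (b : ℝ) / 2 ^ n := by gcongr
    have h4 : 3 * (b : ℝ) / 2 ^ n = 1 / 2 * (6 * b / 2 ^ n) := by ring
    rw [h1, ← mul_sub, abs_mul, abs_of_pos (by norm_num : (0 : ℝ) < 1 / 2), h4]
    exact mul_le_mul_of_nonneg_left ((hg₀ s).trans h3) (by norm_num)
  · rw [Complex.log_im]
    refine (hg₁ s).trans ?_
    gcongr
    exact Real.pi_le_four
  · refine (r₄.union r₁).mono subset_rfl (by omega) ?_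
    simp [Set.insert_subset_iff]

/-- The count of digits is at most `5 + 2 ln x`, and `2 ln x ≤ 1 + ln² x`. -/
theorem exists_two_pow_ge {x : ℝ} (hx : 1 ≤ x) :
    ∃ n : ℕ, 16 * x ≤ 2 ^ n ∧ (n : ℝ) ≤ 6 + Real.log x ^ 2 := by
  have hl := Real.log_two_gt_d9
  have hx0 := Real.log_nonneg hx
  set t := Real.log x / Real.log 2 with ht
  have ht0 : 0 ≤ t := div_nonneg hx0 (by linarith)
  have ht2 : t ≤ 2 * Real.log x := by
    rw [ht, div_le_iff₀ (by linarith)]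
    nlinarith
  refine ⟨4 + ⌈t⌉₊, ?_, ?_⟩
  · have h1 : x = (2 : ℝ) ^ t := by
      rw [Real.rpow_def_of_pos two_pos, ht, mul_comm, div_mul_cancel₀ _ (by positivity),
        Real.exp_log (by linarith)]
    have h2 : (2 : ℝ) ^ t ≤ 2 ^ ⌈t⌉₊ := by
      rw [← Real.rpow_natCast]
      exact Real.rpow_le_rpow_of_exponent_le one_le_two (Nat.le_ceil t)
    rw [pow_add]
    linarith
  · have := Nat.ceil_lt_add_one ht0
    push_cast
    nlinarith [sq_nonneg (Real.log x - 1)]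

theorem corollary1 :
    ∃ C : ℝ, 0 < C ∧
      ∀ (N : ℕ) (d : Fin N → ℕ) (T : TensorNetwork N d) (S : ContractionScheme T) (b : ℕ) (ε : ℝ),
        1 ≤ b → T.HasPrecision b →
        (∀ s, (T.amplitude s).re ≠ 0 ∧ (T.amplitude s).im ≠ 0) →
        0 < ε → ε < 1 →
        ∃ net : NeuralNetwork (Σ i : Fin N, Fin (d i)),
          (∀ s, ‖net.output (indicatorInput s) - Complex.log (T.amplitude s)‖ < ε) ∧
          (net.edges.card : ℝ) ≤
            C * ((S.runTime : ℝ) + Real.log ((S.runTime : ℝ) * (b : ℝ) / ε) ^ 2 +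
              Real.log (1 / ε) * Real.sqrt (1 / ε)) := by
  -- The edges number at most `9 (30 k + 46 n + 22) + 6` with `n ≤ 6 + ln² (b / ε)`, hence at most
  -- `2958 k + 414 ln² (b / ε)` because `k ≥ 1`.
  refine ⟨3000, by norm_num, fun N d T S b ε hb hprec hne hε hε1 => ?_⟩
  have hlast : 0 ≤ Real.log (1 / ε) * Real.sqrt (1 / ε) :=
    mul_nonneg (Real.log_nonneg (by rw [le_div_iff₀ hε]; linarith)) (Real.sqrt_nonneg _)
  rcases isEmpty_or_nonempty ((i : Fin N) → Fin (d i)) with hX | ⟨⟨s₀⟩⟩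
  · obtain ⟨net, h1, h2⟩ :=
      NeuralNetwork.exists_of_isEmpty (fun s => Complex.log (T.amplitude s)) ε
    refine ⟨net, h1, ?_⟩
    rw [h2]
    push_cast
    positivity
  have hd : ∀ i, 1 ≤ d i := fun i => (s₀ i).pos
  -- With a bond of dimension 0 every amplitude would be an empty sum, hence zero.
  obtain ⟨β₀⟩ : Nonempty ((e : Fin T.bonds) → Fin (T.bondDim e)) := by
    by_contra h
    rw [not_nonempty_iff] at h
    exact (hne s₀).1 (by simp [TensorNetwork.amplitude])
  have hk : (1 : ℝ) ≤ S.runTime := by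
    exact_mod_cast T.one_le_cost hd (fun e => (β₀ e).pos) S.tree
  have hb' : (1 : ℝ) ≤ b := by exact_mod_cast hb
  have hbε : 1 ≤ (b : ℝ) / ε := by rw [le_div_iff₀ hε]; linarith
  obtain ⟨n, hn, hn'⟩ := exists_two_pow_ge hbε
  obtain ⟨g, hg0, hg1, r⟩ := Reach.clog (P := inputs d ∪ reIm T.amplitude) (z := T.amplitude)
    Set.subset_union_right hb (fun s => (hprec.2 s).1) (fun s => (hprec.2 s).2)
    (fun s => (hne s).1) (fun s => (hne s).2) n
  -- The factor 1/2 turns `log |Ψ|²` into `log |Ψ|` within the output weights. In units of `ε / 16`,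
  -- simulation costs 1 + 2 in the two outputs and bisection at most 3 + 4, altogether 10.
  obtain ⟨net, hcard, hval⟩ := Reach.exists_neuralNetwork
    (((T.reach_amplitude hd β₀ S).trans r).mono subset_rfl le_rfl Set.subset_union_right)
    ![1 / 2, 1] (δ := ε / 8) (by linarith)
  refine ⟨net, fun s => ?_, ?_⟩
  · have hv := hval s
    change ∀ j, |net.value (indicatorInput s) (net.root j) - _| ≤ _ at hv
    have hv0 := hv 0
    have hv1 := hv 1
    simp only [Matrix.cons_val_zero, Matrix.cons_val_one, one_mul, abs_one,
      abs_of_pos (by norm_num : (0 : ℝ) < 1 / 2)] at hv0 hv1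
    have hpow : (0 : ℝ) < 2 ^ n := by positivity
    have hbn : (b : ℝ) / 2 ^ n ≤ ε / 16 := by
      rw [div_le_iff₀ hpow]
      rw [← mul_div_assoc, div_le_iff₀ hε] at hn
      linarith
    have e0 : 3 * (b : ℝ) / 2 ^ n ≤ 3 * (ε / 16) := by
      rw [mul_div_assoc]; linarith
    have e1 : (4 : ℝ) / 2 ^ n ≤ 4 * (ε / 16) := by
      have : (4 : ℝ) / 2 ^ n ≤ 4 * (b / 2 ^ n) := by
        rw [← mul_div_assoc]
        gcongr
        linarith
      linarith
    refine (Complex.norm_le_abs_re_add_abs_im _).trans_lt ?_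
    have hre : (net.output (indicatorInput s)).re = net.value (indicatorInput s) (net.root 0) := by
      simp [NeuralNetwork.output]
    have him : (net.output (indicatorInput s)).im = net.value (indicatorInput s) (net.root 1) := by
      simp [NeuralNetwork.output]
    rw [Complex.sub_re, Complex.sub_im, hre, him]
    have t0 := abs_sub_le (net.value (indicatorInput s) (net.root 0)) (1 / 2 * g 0 s)
      (Complex.log (T.amplitude s)).re
    have t1 := abs_sub_le (net.value (indicatorInput s) (net.root 1)) (g 1 s)
      (Complex.log (T.amplitude s)).im
    linarith [hg0 s, hg1 s]
  · have h1 : Real.log ((b : ℝ) / ε) ≤ Real.log (S.runTime * b / ε) := by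
      refine Real.log_le_log (by linarith) ?_
      rw [mul_div_assoc]
      nlinarith
    have h2 : Real.log ((b : ℝ) / ε) ^ 2 ≤ Real.log (S.runTime * b / ε) ^ 2 :=
      pow_le_pow_left₀ (Real.log_nonneg hbε) h1 2
    have h3 : (net.edges.card : ℝ) ≤ 9 * (30 * S.runTime + (46 * n + 22)) + 6 := by
      exact_mod_cast hcard
    linarith [sq_nonneg (Real.log (S.runTime * b / ε))]
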